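/- Let $K$ be a finite abstract simplicial complex on a finite vertex set $V$, and let $\{X_i\}_{i\in V}$ be a family of non-empty finite CW complexes. For a vertex $v$ write $\mathrm{st}_K(v)=\{\sigma\in K \mid \sigma\cup\{v\}\in K\}$, $\mathrm{dl}_K(v)=\{\sigma\in K\mid v\notin\sigma\}$ and $\mathrm{lk}_K(v)=\{\sigma\in K\mid \sigma\cup\{v\}\in K,\ v\notin\sigma\}$. For a subcomplex $L\subseteq K$ let $$\mathcal Z^*_L(\underline X)=\bigcup_{\sigma\in L}\ast_{i\in V}\,Y_i^\sigma\subseteq \ast_{i\in V}X_i,\qquad Y_i^\sigma=X_i\ (i\in\sigma),\quad Y_i^\sigma=\emptyset\ (i\notin\sigma),$$ be the polyhedral join of the pairs $(X_i,\emptyset)$ over $L$; here $*$ denotes the join of spaces, and $\Sigma Y=Y*S^0$ denotes the unreduced suspension. Suppose that $K$ has vertices $v,w$ such that $\mathrm{lk}_K(v)$ contains a non-empty simplex and $\mathrm{dl}_K(v)=\mathrm{st}_K(w)$. Then there is a homotopy equivalence $$\mathcal Z^*_K(\underline X)\;\simeq\;\Sigma \mathcal Z^*_{\mathrm{lk}_K(v)}(\underline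 X)\;\vee\;\bigl(\mathcal Z^*_{\mathrm{lk}_K(v)}(\underline X)*X_v\bigr)\;\vee\;\mathcal Z^*_{\mathrm{dl}_K(v)}(\underline X),$$ where the wedge sum may be formed with respect to any choice of base points in its three summands. -/

import Mathlib

open Set

/-! ### Star, deletion and link

A simplicial complex on a finite vertex set `V` is a `PreAbstractSimplicialComplex V`: a family of
nonempty finite subsets of `V` closed under passing to nonempty subsets. The empty simplex is left
implicit, so the complex whose only simplex is the empty one is `⊥`. -/

section Complexes

variable {V : Type*} [DecidableEq V]

/-- The star of `v` in `K`: the simplices `σ` of `K` with `σ ∪ {v}` in `K`. -/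
def starComplex (K : PreAbstractSimplicialComplex V) (v : V) : PreAbstractSimplicialComplex V where
  faces := {σ | σ ∈ K ∧ insert v σ ∈ K}
  isRelLowerSet_faces := by
    rintro σ ⟨h1, h2⟩
    refine ⟨(K.isRelLowerSet_faces h1).1, fun τ hτ hne => ⟨?_, ?_⟩⟩
    · exact (K.isRelLowerSet_faces h1).2 hτ hne
    · exact (K.isRelLowerSet_faces h2).2 (Finset.insert_subset_insert v hτ)
        (Finset.insert_nonempty v τ)

/-- The deletion of `v` from `K`: the simplices of `K` that do not contain `v`. -/
def deletionComplex (K : PreAbstractSimplicialComplex V) (v : V) :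
    PreAbstractSimplicialComplex V where
  faces := {σ | σ ∈ K ∧ v ∉ σ}
  isRelLowerSet_faces := by
    rintro σ ⟨h1, h2⟩
    exact ⟨(K.isRelLowerSet_faces h1).1, fun τ hτ hne =>
      ⟨(K.isRelLowerSet_faces h1).2 hτ hne, fun h => h2 (hτ h)⟩⟩

/-- The link of `v` in `K`: the simplices `σ` of `K` with `v ∉ σ` and `σ ∪ {v}` in `K`. -/
def linkComplex (K : PreAbstractSimplicialComplex V) (v : V) : PreAbstractSimplicialComplex V where
  faces := {σ | σ ∈ K ∧ insert v σ ∈ K ∧ v ∉ σ}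
  isRelLowerSet_faces := by
    rintro σ ⟨h1, h2, h3⟩
    refine ⟨(K.isRelLowerSet_faces h1).1, fun τ hτ hne => ⟨?_, ?_, fun h => h3 (hτ h)⟩⟩
    · exact (K.isRelLowerSet_faces h1).2 hτ hne
    · exact (K.isRelLowerSet_faces h2).2 (Finset.insert_subset_insert v hτ)
        (Finset.insert_nonempty v τ)

end Complexes

/-! ### Binary join, suspension and wedge sum -/

/-- The gluing of `X ⊔ Y ⊔ X × Y × [0,1]` that produces the join: `(x, y, 0)` is glued to `x` and
`(x, y, 1)` is glued to `y`. -/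
inductive JoinRel (X Y : Type*) : X ⊕ Y ⊕ X × Y × unitInterval →
    X ⊕ Y ⊕ X × Y × unitInterval → Prop
  | left (x : X) (y : Y) : JoinRel X Y (.inr (.inr (x, y, 0))) (.inl x)
  | right (x : X) (y : Y) : JoinRel X Y (.inr (.inr (x, y, 1))) (.inr (.inl y))

/-- The join `X * Y`, with the quotient topology. -/
def TopJoin (X Y : Type*) : Type _ := Quot (JoinRel X Y)

instance (X Y : Type*) [TopologicalSpace X] [TopologicalSpace Y] :
    TopologicalSpace (TopJoin X Y) :=
  inferInstanceAs (TopologicalSpace (Quot (JoinRel X Y)))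

/-- The unreduced suspension `Σ X = X * S⁰`, where `S⁰` is the unit sphere of `ℝ`. -/
abbrev Suspension (X : Type*) : Type _ := TopJoin X (Metric.sphere (0 : ℝ) 1)

/-- The gluing of `X ⊔ Y` that produces the wedge sum: the two base points are identified. -/
inductive WedgeRel {X Y : Type*} (x : X) (y : Y) : X ⊕ Y → X ⊕ Y → Prop
  | glue : WedgeRel x y (.inl x) (.inr y)

/-- The wedge sum `(X, x) ∨ (Y, y)`, with the quotient topology. -/
def Wedge {X Y : Type*} (x : X) (y : Y) : Type _ := Quot (WedgeRel x y)

instance {X Y : Type*} [TopologicalSpace X] [TopologicalSpace Y] (x : X) (y : Y) :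
    TopologicalSpace (Wedge x y) :=
  inferInstanceAs (TopologicalSpace (Quot (WedgeRel x y)))

/-- The base point of the wedge sum. -/
def Wedge.base {X Y : Type*} (x : X) (y : Y) : Wedge x y := Quot.mk _ (.inl x)

/-! ### Joins of finite families and polyhedral joins -/

section FamilyJoin

variable {V : Type*} [Fintype V] (X : V → Type*)

/-- Formal convex combinations `∑ tᵢ xᵢ` with `xᵢ ∈ Xᵢ`: barycentric coordinates `t` supported in a
set `σ` of indices, and a point `xᵢ` for each `i ∈ σ`. The points are indexed by a varying `σ` so
that empty `Xᵢ` are allowed. As a space this is the disjoint union over `σ ⊆ V` of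
`Δ^σ × ∏_{i ∈ σ} Xᵢ`. -/
abbrev JoinRep : Type _ :=
  Σ σ : Finset V, {t : stdSimplex ℝ V // ∀ i, i ∉ σ → t.1 i = 0} × ((i : σ) → X i)

/-- Two formal convex combinations are equal if they have the same coefficients and the same points
at every index with nonzero coefficient. -/
def joinSetoid : Setoid (JoinRep X) where
  r p q := p.2.1.1 = q.2.1.1 ∧
    ∀ (i : V) (hp : i ∈ p.1) (hq : i ∈ q.1), p.2.1.1.1 i ≠ 0 → p.2.2 ⟨i, hp⟩ = q.2.2 ⟨i, hq⟩
  iseqv :=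
    { refl := fun _ => ⟨rfl, fun _ _ _ _ => rfl⟩
      symm := fun {p q} h => ⟨h.1.symm, fun i hp hq hi =>
        (h.2 i hq hp (by rw [h.1]; exact hi)).symm⟩
      trans := fun {p q r} h h' => ⟨h.1.trans h'.1, fun i hp hr hi => by
        have hi' : q.2.1.1.1 i ≠ 0 := by rw [← h.1]; exact hi
        have hq : i ∈ q.1 := by
          by_contra hn
          exact hi' (q.2.1.2 i hn)
        exact (h.2 i hp hq hi).trans (h'.2 i hq hr hi')⟩ }

/-- The join `X₁ * ⋯ * X_m` of a finite family of spaces, with the quotient topology. -/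
def FamilyJoin : Type _ := Quotient (joinSetoid X)

instance [∀ i, TopologicalSpace (X i)] : TopologicalSpace (FamilyJoin X) :=
  inferInstanceAs (TopologicalSpace (Quotient (joinSetoid X)))

/-- For subsets `Yᵢ ⊆ Xᵢ`, the subset `Y₁ * ⋯ * Y_m` of `X₁ * ⋯ * X_m`. -/
def subJoin (Y : ∀ i, Set (X i)) : Set (FamilyJoin X) :=
  {z | ∃ p : JoinRep X, (∀ i : p.1, p.2.2 i ∈ Y i) ∧ Quotient.mk (joinSetoid X) p = z}

open scoped Classical in
/-- The polyhedral join of the pairs `(Xᵢ, ∅)` over `K`: the union in `X₁ * ⋯ * X_m` over the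
simplices `σ` of `K` of the joins `Y₁ * ⋯ * Y_m`, where `Yᵢ = Xᵢ` if `i ∈ σ` and `Yᵢ = ∅` if
`i ∉ σ`. (The empty simplex would contribute the empty set.) It carries the subspace topology. -/
def polyhedralJoin (K : PreAbstractSimplicialComplex V) : Set (FamilyJoin X) :=
  ⋃ σ ∈ K, subJoin X (fun i => if i ∈ σ then univ else ∅)

end FamilyJoin

/-!
Write `A`, `C` for the polyhedral joins over the link and the deletion of `v`, and `J` for the join of
`A` with `X v`. The polyhedral join over the star of `v` is `J`, so that the polyhedral join over `K`
is the pushout of the inclusions `A → J` and `A → C`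
(`FamilyJoin.exists_isPushoutSq_polyhedralJoin`); here compactness reduces the comparison of
topologies to a bijection of sets. Both inclusions are null-homotopic: in `J` one contracts `A` to a
point of `X v`, and in `C`, which is the polyhedral join over the star of `w`, one contracts `A` to a
point of `X w` (`FamilyJoin.linkInclusion_homotopic_const`).

Since `A → J` is a cofibration (`TopJoin.isCofib_inl`), the pushout is homotopy equivalent to the
double mapping cylinder of the two inclusions
(`IsPushoutSq.homotopyEquiv_doubleMappingCylinder`). The ends of a cylinder form a cofibration, so
that the homotopy type of a double mapping cylinder depends only on the homotopy classes of the two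
maps (`IsPushoutSq.homotopyEquiv_of_homotopic`), and for constant maps it is a wedge sum of `C`, the
suspension of `A`, and `J` (`exists_isPushoutSq_wedge_suspension`).

In this wedge sum the suspension is attached at its two poles. By the same theorem on pushouts the
base points can be moved within the path connected suspension if the base points `b` of `J` and `c`
of `C` are cofibrations. This is where the CW structures enter: for a point of a finite CW complex
the homotopy extension property is proved by induction on skeleta
(`isCofib_const_of_finite_CWComplex`), and it is equivalent to the existence of a function vanishing
exactly at the point together with a contraction of a neighbourhood (`NDRPoint`). In this
form it passes from the spaces `X i` to polyhedral joins, since contractions of the `X i` and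
segments in the simplex of barycentric coordinates combine to contractions that preserve all
polyhedral joins (`FamilyJoin.exists_ndrPoint`).
-/

universe u v

/-! ### Pushouts and the homotopy extension property -/

open unitInterval in
/-- A family of paths, i.e. a continuous map into a space of paths, is a homotopy between the maps
of start and end points. -/
theorem ContinuousMap.Homotopic.of_paths {X Y : Type*} [TopologicalSpace X] [TopologicalSpace Y]
    {f g : C(X, Y)} (G : C(X, C(I, Y))) (h0 : ∀ x, G x 0 = f x) (h1 : ∀ x, G x 1 = g x) :
    f.Homotopic g :=
  ⟨{ toFun := fun p => G p.2 p.1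
     continuous_toFun := by fun_prop
     map_zero_left := h0
     map_one_left := h1 }⟩

/-- The point with parameter `s` on the segment from `t` to `t'`. -/
def unitInterval.mix (s t t' : unitInterval) : unitInterval :=
  ⟨(1 - s) * t + s * t', by
    constructor
    · have := mul_nonneg (unitInterval.one_minus_nonneg s) t.2.1
      have := mul_nonneg s.2.1 t'.2.1
      linarith
    · have := mul_le_mul_of_nonneg_left t.2.2 (unitInterval.one_minus_nonneg s)
      have := mul_le_mul_of_nonneg_left t'.2.2 s.2.1
      linarith⟩

@[fun_prop]
theorem unitInterval.continuous_mix {Y : Type*} [TopologicalSpace Y] {a b c : Y → unitInterval}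
    (ha : Continuous a) (hb : Continuous b) (hc : Continuous c) :
    Continuous fun y => unitInterval.mix (a y) (b y) (c y) := by
  unfold unitInterval.mix
  fun_prop

@[simp] theorem unitInterval.mix_zero (t t' : unitInterval) : unitInterval.mix 0 t t' = t := by
  ext; simp [unitInterval.mix]

@[simp] theorem unitInterval.mix_one (t t' : unitInterval) : unitInterval.mix 1 t t' = t' := by
  ext; simp [unitInterval.mix]

@[simp] theorem unitInterval.mix_self (s t : unitInterval) : unitInterval.mix s t t = t := by
  ext; simp only [unitInterval.mix]; ring

/-- The square with maps `i : A → X`, `f : A → Y`, `j : X → P`, `g : Y → P` is a pushout square of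
topological spaces. Uniqueness of the maps out of `P` is expressed by `surj`. As in a category of
spaces, all spaces live in one universe. -/
structure IsPushoutSq {A X Y P : Type u} [TopologicalSpace A] [TopologicalSpace X]
    [TopologicalSpace Y] [TopologicalSpace P]
    (i : C(A, X)) (f : C(A, Y)) (j : C(X, P)) (g : C(Y, P)) : Prop where
  comm : ∀ a, j (i a) = g (f a)
  surj : ∀ z, (∃ x, j x = z) ∨ ∃ y, g y = z
  desc : ∀ {Z : Type u} [TopologicalSpace Z] (p : C(X, Z)) (q : C(Y, Z)),
    (∀ a, p (i a) = q (f a)) → ∃ r : C(P, Z), (∀ x, r (j x) = p x) ∧ ∀ y, r (g y) = q y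

/-- The inclusion `i` has the homotopy extension property. Homotopies are written as continuous maps
into spaces of paths, and their targets live in the universe of `A` and `X`. -/
def IsCofib {A X : Type u} [TopologicalSpace A] [TopologicalSpace X] (i : C(A, X)) : Prop :=
  ∀ {Z : Type u} [TopologicalSpace Z] (F : C(X, Z)) (H : C(A, C(unitInterval, Z))),
    (∀ a, H a 0 = F (i a)) →
      ∃ G : C(X, C(unitInterval, Z)), (∀ x, G x 0 = F x) ∧ ∀ a, G (i a) = H a

section Pushout

variable {A X Y P : Type u} [TopologicalSpace A] [TopologicalSpace X]
    [TopologicalSpace Y] [TopologicalSpace P]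

theorem IsPushoutSq.symm {i : C(A, X)} {f : C(A, Y)} {j : C(X, P)} {g : C(Y, P)}
    (h : IsPushoutSq i f j g) : IsPushoutSq f i g j where
  comm a := (h.comm a).symm
  surj z := (h.surj z).symm
  desc p q hpq := by
    obtain ⟨r, h1, h2⟩ := h.desc q p fun a => (hpq a).symm
    exact ⟨r, h2, h1⟩

/-- The gluing of `X ⊔ Y` along `A` that produces the pushout. -/
inductive PushoutRel (i : C(A, X)) (f : C(A, Y)) : X ⊕ Y → X ⊕ Y → Prop
  | glue (a : A) : PushoutRel i f (.inl (i a)) (.inr (f a))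

theorem exists_isPushoutSq (i : C(A, X)) (f : C(A, Y)) :
    ∃ (P : Type u) (_ : TopologicalSpace P) (j : C(X, P)) (g : C(Y, P)), IsPushoutSq i f j g := by
  refine ⟨Quot (PushoutRel i f), inferInstance,
    ⟨fun x => Quot.mk _ (.inl x), continuous_quot_mk.comp continuous_inl⟩,
    ⟨fun x => Quot.mk _ (.inr x), continuous_quot_mk.comp continuous_inr⟩,
    fun a => Quot.sound (.glue a), ?_, ?_⟩
  · rintro ⟨x | y⟩
    · exact .inl ⟨x, rfl⟩
    · exact .inr ⟨y, rfl⟩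
  · intro Z _ p q hpq
    refine ⟨⟨Quot.lift (Sum.elim p q) ?_, continuous_quot_lift _ (by fun_prop)⟩,
      fun _ => rfl, fun _ => rfl⟩
    rintro _ _ ⟨a⟩
    exact hpq a

open ContinuousMap

/-- Paths `s ↦ F (x, s)` depending continuously on `x`. -/
theorem exists_path_family {Z : Type*} [TopologicalSpace Z] (F : X → unitInterval → Z)
    (hF : Continuous fun p : X × unitInterval => F p.1 p.2) :
    ∃ G : C(X, C(unitInterval, Z)), ∀ x s, G x s = F x s :=
  ⟨ContinuousMap.curry ⟨_, hF⟩, fun _ _ => rfl⟩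

/-- Two maps from a pushout are homotopic if there are homotopies on both parts that agree on the
glued part. -/
theorem IsPushoutSq.homotopic {i : C(A, X)} {f : C(A, Y)} {j : C(X, P)} {g : C(Y, P)}
    (h : IsPushoutSq i f j g) {Z : Type u} [TopologicalSpace Z] {φ ψ : C(P, Z)}
    (G : X → unitInterval → Z) (H : Y → unitInterval → Z)
    (hG : Continuous fun p : X × unitInterval => G p.1 p.2)
    (hH : Continuous fun p : Y × unitInterval => H p.1 p.2)
    (hGH : ∀ a s, G (i a) s = H (f a) s)
    (hG0 : ∀ x, G x 0 = φ (j x)) (hG1 : ∀ x, G x 1 = ψ (j x))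
    (hH0 : ∀ x, H x 0 = φ (g x)) (hH1 : ∀ x, H x 1 = ψ (g x)) : φ.Homotopic ψ := by
  obtain ⟨G', hG'⟩ := exists_path_family G hG
  obtain ⟨H', hH'⟩ := exists_path_family H hH
  obtain ⟨r, hr1, hr2⟩ := h.desc G' H' fun a => by ext s; rw [hG', hH', hGH]
  refine .of_paths r (fun z => ?_) fun z => ?_ <;> obtain ⟨x, rfl⟩ | ⟨y, rfl⟩ := h.surj z
  · rw [hr1, hG', hG0]
  · rw [hr2, hH', hH0]
  · rw [hr1, hG', hG1]
  · rw [hr2, hH', hH1]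

/-- If `i : A → X` is a cofibration then the pushout of `i` and `f` is a deformation retract of the
space obtained by gluing `X × [0,1]` along a homotopy `A × [0,1] → Y` that starts at `f`. -/
theorem IsPushoutSq.homotopyEquiv_of_homotopy {W : Type u} [TopologicalSpace W]
    {i : C(A, X)} (hi : IsCofib i)
    {f : C(A, Y)} {j : C(X, P)} {g : C(Y, P)} (h : IsPushoutSq i f j g)
    {F : C(A × unitInterval, Y)} (hF : ∀ a, F (a, 0) = f a)
    {jW : C(X × unitInterval, W)} {gW : C(Y, W)}
    (hW : IsPushoutSq (i.prodMap (.id unitInterval)) F jW gW) :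
    Nonempty (P ≃ₕ W) := by
  -- `Z` is the mapping cylinder of `i`, and `k` the universal homotopy extension.
  obtain ⟨Z, _, kX, kA, hZ⟩ := exists_isPushoutSq i
    (⟨fun a => (a, 0), by fun_prop⟩ : C(A, A × unitInterval))
  obtain ⟨k, hk0, hkA⟩ := hi kX (ContinuousMap.curry kA) fun a => (hZ.comm a).symm
  have hkA (a t) : k (i a) t = kA (a, t) := by rw [hkA]; rfl
  obtain ⟨e, heX, heA⟩ := hZ.desc (⟨fun x => (x, 0), by fun_prop⟩ : C(X, X × unitInterval))
    (i.prodMap (.id _)) fun a => rfl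
  obtain ⟨l, hlX, hlA⟩ := hZ.desc j (g.comp F) fun a => by simp [h.comm, hF]
  have hWc (a t) : jW (i a, t) = gW (F (a, t)) := hW.comm (a, t)
  obtain ⟨ι, hιX, hιY⟩ := h.desc (jW.comp ⟨fun x => (x, 0), by fun_prop⟩) gW fun a => by
    simp [hWc, hF]
  obtain ⟨ρ, hρX, hρY⟩ := hW.desc (⟨fun p => l (k p.1 p.2), by fun_prop⟩ :
    C(X × unitInterval, P)) g fun a => by simp [hkA, hlA]
  have hιl (z) : ι (l z) = jW (e z) := by
    obtain ⟨x, rfl⟩ | ⟨⟨a, t⟩, rfl⟩ := hZ.surj z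
    · rw [hlX, hιX, heX]; rfl
    · rw [hlA, heA, ContinuousMap.comp_apply, hιY]
      exact (hWc a t).symm
  refine ⟨⟨ι, ρ, ?_, ?_⟩⟩
  · have : ρ.comp ι = .id P := by
      ext z
      obtain ⟨x, rfl⟩ | ⟨y, rfl⟩ := h.surj z
      · simp [hιX, hρX, hk0, hlX]
      · simp [hιY, hρY]
    rw [this]
  · symm
    refine hW.homotopic
      (fun p s => jW ((e (k p.1 (s * p.2))).1, unitInterval.mix s p.2 (e (k p.1 p.2)).2))
      (fun y _ => gW y) (by fun_prop) (by fun_prop) ?_ ?_ ?_ (fun _ => rfl) ?_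
    · rintro ⟨a, t⟩ s
      simp [hkA, heA, hWc]
    · rintro ⟨x, t⟩
      simp [hk0, heX]
    · rintro ⟨x, t⟩
      simp [hρX, hιl]
    · intro y
      simp [hρY, hιY]

/-- The homotopy type of a pushout along a cofibration depends only on the homotopy class of the
attaching map. -/
theorem IsPushoutSq.homotopyEquiv_of_homotopic {P' : Type u} [TopologicalSpace P']
    {i : C(A, X)} (hi : IsCofib i) {f f' : C(A, Y)} {j : C(X, P)} {g : C(Y, P)}
    (h : IsPushoutSq i f j g) {j' : C(X, P')} {g' : C(Y, P')} (h' : IsPushoutSq i f' j' g')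
    (hf : f.Homotopic f') : Nonempty (P ≃ₕ P') := by
  obtain ⟨H⟩ := hf
  let F : C(A × unitInterval, Y) := ⟨fun p => H (p.2, p.1), by fun_prop⟩
  obtain ⟨W, _, jW, gW, hW⟩ := exists_isPushoutSq (i.prodMap (.id unitInterval)) F
  obtain ⟨e⟩ := h.homotopyEquiv_of_homotopy hi (F := F) (by simp [F]) hW
  let F' : C(A × unitInterval, Y) := ⟨fun p => F (p.1, unitInterval.symm p.2), by fun_prop⟩
  let jW' : C(X × unitInterval, W) := ⟨fun p => jW (p.1, unitInterval.symm p.2), by fun_prop⟩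
  have hW' : IsPushoutSq (i.prodMap (.id unitInterval)) F' jW' gW :=
    { comm := fun a => hW.comm (a.1, unitInterval.symm a.2)
      surj := fun z => by
        obtain ⟨x, rfl⟩ | hz := hW.surj z
        · exact .inl ⟨(x.1, unitInterval.symm x.2), by simp [jW']⟩
        · exact .inr hz
      desc := fun p q hpq => by
        obtain ⟨r, h1, h2⟩ := hW.desc (p.comp ⟨fun x => (x.1, unitInterval.symm x.2), by fun_prop⟩)
          q fun a => by
            have := hpq (a.1, unitInterval.symm a.2)
            simpa [F'] using this
        refine ⟨r, fun x => ?_, h2⟩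
        have := h1 (x.1, unitInterval.symm x.2)
        simpa [jW'] using this }
  obtain ⟨e'⟩ := h'.homotopyEquiv_of_homotopy hi (F := F') (by simp [F', F]) hW'
  exact ⟨e.trans e'.symm⟩

/-- The inclusion of the two ends of the cylinder on `A`. -/
def cylinderEnds (A : Type u) [TopologicalSpace A] : C(A ⊕ A, A × unitInterval) :=
  ⟨Sum.elim (fun a => (a, 0)) fun a => (a, 1), by fun_prop⟩

/-- If `i : A → X` is a cofibration then the pushout of `i` and `f : A → Y` is homotopy equivalent
to the double mapping cylinder of `f` and `i`. -/
theorem IsPushoutSq.homotopyEquiv_doubleMappingCylinder {M : Type u} [TopologicalSpace M]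
    {i : C(A, X)} (hi : IsCofib i) {f : C(A, Y)} {j : C(X, P)} {g : C(Y, P)}
    (h : IsPushoutSq i f j g) {jM : C(A × unitInterval, M)} {gM : C(Y ⊕ X, M)}
    (hM : IsPushoutSq (cylinderEnds A) ⟨Sum.map f i, by fun_prop⟩ jM gM) :
    Nonempty (P ≃ₕ M) := by
  have hM0 (a) : jM (a, 0) = gM (.inl (f a)) := hM.comm (.inl a)
  have hM1 (a) : jM (a, 1) = gM (.inr (i a)) := hM.comm (.inr a)
  -- `L` pulls `X` through the cylinder, so that at time `1` its part `A` has arrived in `Y`.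
  obtain ⟨L, hL0, hLA⟩ := hi (gM.comp ⟨Sum.inr, by fun_prop⟩)
    (ContinuousMap.curry ⟨fun p => jM (p.1, unitInterval.symm p.2), by fun_prop⟩)
    fun a => by simp [hM1]
  have hLA (a s) : L (i a) s = jM (a, unitInterval.symm s) := by rw [hLA]; rfl
  obtain ⟨σ, hσX, hσY⟩ := h.desc (⟨fun x => L x 1, by fun_prop⟩ : C(X, M))
    (gM.comp ⟨Sum.inl, by fun_prop⟩) fun a => by simp [hLA, hM0]
  obtain ⟨π, hπA, hπS⟩ := hM.desc (j.comp (i.comp .fst)) (⟨Sum.elim g j, by fun_prop⟩ :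
    C(Y ⊕ X, P)) (by rintro (a | a) <;> simp [cylinderEnds, h.comm])
  refine ⟨⟨σ, π, ?_, ?_⟩⟩
  · symm
    refine h.homotopic (fun x s => π (L x s)) (fun y _ => g y) (by fun_prop) (by fun_prop)
      ?_ ?_ ?_ (fun _ => rfl) ?_
    · intro a s
      simp [hLA, hπA, h.comm]
    · intro x
      simp [hL0, hπS]
    · intro x
      simp [hσX]
    · intro y
      simp [hσY, hπS]
  · symm
    refine hM.homotopic (fun p s => jM (p.1, unitInterval.symm s * p.2))
      (fun y s => Sum.elim (fun y => gM (.inl y)) (fun x => L x s) y) (by fun_prop) ?_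
      ?_ ?_ ?_ ?_ ?_
    · rw [← (Homeomorph.sumProdDistrib).symm.comp_continuous_iff', continuous_sum_dom]
      constructor
      · exact (by fun_prop : Continuous fun p : Y × unitInterval => gM (.inl p.1))
      · exact (by fun_prop : Continuous fun p : X × unitInterval => L p.1 p.2)
    · rintro (a | a) s
      · simp [cylinderEnds, hM0]
      · simp [cylinderEnds, hLA]
    · simp
    · rintro ⟨a, t⟩
      simp [hπA, h.comm, hσY, hM0]
    · rintro (y | x) <;> simp [hL0]
    · rintro (y | x) <;> simp [hπS, hσY, hσX]

end Pushout

/-! ### Examples of cofibrations -/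

/-- Truncation of a real number to the unit interval. -/
noncomputable abbrev unitInterval.trunc (r : ℝ) : unitInterval := projIcc 0 1 zero_le_one r

@[fun_prop]
theorem unitInterval.continuous_trunc {Y : Type*} [TopologicalSpace Y] {a : Y → ℝ}
    (ha : Continuous a) : Continuous fun y => unitInterval.trunc (a y) :=
  continuous_projIcc.comp ha

theorem unitInterval.trunc_of_le {r : ℝ} (h : r ≤ 0) : unitInterval.trunc r = 0 :=
  projIcc_of_le_left _ h

theorem unitInterval.trunc_of_ge {r : ℝ} (h : 1 ≤ r) : unitInterval.trunc r = 1 :=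
  projIcc_of_right_le _ h

@[simp] theorem unitInterval.trunc_coe (t : unitInterval) : unitInterval.trunc t = t :=
  projIcc_val _ t

theorem unitInterval.coe_trunc {r : ℝ} (h : r ∈ unitInterval) : (unitInterval.trunc r : ℝ) = r := by
  rw [unitInterval.trunc, projIcc_of_mem _ h]

namespace TopJoin

variable {A B : Type*} [TopologicalSpace A] [TopologicalSpace B]

/-- The inclusion of the first factor into the join. -/
def inl : C(A, TopJoin A B) := ⟨fun a => Quot.mk _ (.inl a), continuous_quot_mk.comp (by fun_prop)⟩

/-- The inclusion of the second factor into the join. -/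
def inr : C(B, TopJoin A B) :=
  ⟨fun b => Quot.mk _ (.inr (.inl b)), continuous_quot_mk.comp (by fun_prop)⟩

/-- The point of the join on the segment from `a` to `b` with parameter `t`. -/
def mk : C(A × B × unitInterval, TopJoin A B) :=
  ⟨fun p => Quot.mk _ (.inr (.inr p)), continuous_quot_mk.comp (by fun_prop)⟩

@[simp] theorem mk_zero (a : A) (b : B) : mk (a, b, 0) = inl a := Quot.sound (.left a b)

@[simp] theorem mk_one (a : A) (b : B) : mk (a, b, 1) = inr b := Quot.sound (.right a b)

theorem cases (z : TopJoin A B) :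
    (∃ a, inl a = z) ∨ (∃ b, inr b = z) ∨ ∃ a b t, mk (a, b, t) = z := by
  obtain ⟨a | b | ⟨a, b, t⟩⟩ := z
  · exact .inl ⟨a, rfl⟩
  · exact .inr (.inl ⟨b, rfl⟩)
  · exact .inr (.inr ⟨a, b, t, rfl⟩)

/-- Every point of the join of nonempty spaces lies on a segment. -/
theorem mk_surjective [Nonempty A] [Nonempty B] : Function.Surjective (mk : _ → TopJoin A B) := by
  intro z
  obtain ⟨a, rfl⟩ | ⟨b, rfl⟩ | ⟨a, b, t, rfl⟩ := cases z
  · exact ⟨(a, Classical.arbitrary B, 0), mk_zero _ _⟩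
  · exact ⟨(Classical.arbitrary A, b, 1), mk_one _ _⟩
  · exact ⟨_, rfl⟩

theorem exists_desc {Z : Type*} [TopologicalSpace Z] (f : C(A, Z)) (g : C(B, Z))
    (h : C(A × B × unitInterval, Z)) (h0 : ∀ a b, h (a, b, 0) = f a)
    (h1 : ∀ a b, h (a, b, 1) = g b) :
    ∃ r : C(TopJoin A B, Z), (∀ a, r (inl a) = f a) ∧ (∀ b, r (inr b) = g b) ∧
      ∀ p, r (mk p) = h p := by
  refine ⟨⟨Quot.lift (Sum.elim f (Sum.elim g h)) ?_, continuous_quot_lift _ (by fun_prop)⟩,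
    fun _ => rfl, fun _ => rfl, fun _ => rfl⟩
  rintro _ _ (⟨a, b⟩ | ⟨a, b⟩)
  · exact h0 a b
  · exact h1 a b

instance [CompactSpace A] [CompactSpace B] : CompactSpace (TopJoin A B) :=
  inferInstanceAs (CompactSpace (Quot _))

theorem joined_inl_inr (a : A) (b : B) : Joined (inl a : TopJoin A B) (inr b) :=
  ⟨{ toFun := fun t => mk (a, b, t)
     continuous_toFun := by fun_prop
     source' := by simp
     target' := by simp }⟩

theorem joined_mk (a : A) (b : B) (t : unitInterval) :
    Joined (inl a : TopJoin A B) (mk (a, b, t)) :=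
  ⟨{ toFun := fun s => mk (a, b, s * t)
     continuous_toFun := by fun_prop
     source' := by simp
     target' := by simp }⟩

/-- The join of two nonempty spaces is path connected. -/
theorem joined [Nonempty A] [Nonempty B] (z z' : TopJoin A B) : Joined z z' := by
  obtain ⟨⟨a, b, t⟩, rfl⟩ := mk_surjective z
  obtain ⟨⟨a', b', t'⟩, rfl⟩ := mk_surjective z'
  exact (joined_mk a b t).symm.trans ((joined_inl_inr a b).trans
    ((joined_inl_inr a' b).symm.trans (joined_mk a' b' t')))

end TopJoin

open unitInterval in
/-- The inclusion of a factor into the join is a cofibration. In the collar of that factor a homotopy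
is extended by means of the retraction of `[0,1] × [0,1]` onto two adjacent sides. -/
theorem TopJoin.isCofib_inl {A : Type (max u v)} {B : Type v} [TopologicalSpace A]
    [TopologicalSpace B] : IsCofib (TopJoin.inl : C(A, TopJoin A B)) := by
  intro Z _ F H hFH
  let c (s t : I) : ℝ := (1 + s) * (1 - t)
  let m (p : (A × B × I) × I) : Z :=
    if c p.2 p.1.2.2 ≤ 1 then F (mk (p.1.1, p.1.2.1, trunc (1 - c p.2 p.1.2.2)))
    else H p.1.1 (trunc (c p.2 p.1.2.2 - 1))
  have hm : Continuous m := by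
    refine Continuous.if_le (by fun_prop) (by fun_prop) (by fun_prop) (by fun_prop) ?_
    intro p hp
    simp [hp, hFH]
  have hm0 (a : A) (b : B) : ContinuousMap.curry ⟨m, hm⟩ (a, b, 0) = H a := by
    ext s
    change m ((a, b, 0), s) = _
    by_cases hs : (1 + s : ℝ) ≤ 1
    · have : s = 0 := by ext; simpa using le_antisymm (by linarith) s.2.1
      subst this
      simp [m, c, hFH]
    · simp [m, c, hs]
  have hm1 (a : A) (b : B) : ContinuousMap.curry ⟨m, hm⟩ (a, b, 1) =
      (ContinuousMap.curry ⟨fun p => F (inr p.1), by fun_prop⟩ : C(B, C(I, Z))) b := by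
    ext s
    change m ((a, b, 1), s) = F (inr b)
    simp [m, c]
  obtain ⟨r, hrA, hrB, hrm⟩ := exists_desc H _ _ hm0 hm1
  refine ⟨r, fun z => ?_, hrA⟩
  obtain ⟨a, rfl⟩ | ⟨b, rfl⟩ | ⟨a, b, t, rfl⟩ := cases z
  · rw [hrA, hFH]
  · rw [hrB]; rfl
  · have ht : (1 - t : ℝ) ≤ 1 := by linarith [t.2.1]
    rw [hrm]
    change m ((a, b, t), 0) = _
    simp [m, c, ht]

open unitInterval in
theorem isCofib_cylinderEnds (A : Type u) [TopologicalSpace A] : IsCofib (cylinderEnds A) := by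
  intro Z _ F H hFH
  have h0 (a) : H (.inl a) 0 = F (a, 0) := hFH _
  have h1 (a) : H (.inr a) 0 = F (a, 1) := hFH _
  -- The height `t` is stretched away from the middle; what leaves `[0, 1]` follows the homotopy.
  let c (s t : I) : ℝ := (1 + s) * (2 * t - 1)
  let m (p : (A × I) × I) : Z :=
    if c p.2 p.1.2 ≤ -1 then H (.inl p.1.1) (trunc (- c p.2 p.1.2 - 1)) else
      if c p.2 p.1.2 ≤ 1 then F (p.1.1, trunc ((c p.2 p.1.2 + 1) / 2))
      else H (.inr p.1.1) (trunc (c p.2 p.1.2 - 1))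
  have hm : Continuous m := by
    refine Continuous.if_le (by fun_prop) (Continuous.if_le (by fun_prop) (by fun_prop)
      (by fun_prop) (by fun_prop) ?_) (by fun_prop) (by fun_prop) ?_
    · intro p hp
      norm_num [hp, h1, trunc_of_le, trunc_of_ge]
    · intro p hp
      norm_num [hp, h0, trunc_of_le]
  refine ⟨ContinuousMap.curry ⟨m, hm⟩, ?_, ?_⟩
  · rintro ⟨a, t⟩
    have e : (c 0 t + 1) / 2 = t := by simp only [c, Icc.coe_zero]; ring
    change m ((a, t), 0) = _
    simp only [m, e]
    have h3 : c 0 t ≤ 1 := by have := t.2.2; simp only [c, Icc.coe_zero]; linarith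
    split_ifs with h2
    · have : t = 0 := by
        ext
        have := t.2.1
        simp only [c, Icc.coe_zero] at h2 ⊢
        linarith
      subst this
      simp [c, h0]
    · simp
  · rintro (a | a)
    · ext s
      change m ((a, 0), s) = _
      have hs : c s 0 = -(1 + s) := by simp [c]
      have := s.2.1
      have h2 : c s 0 ≤ -1 := by rw [hs]; linarith
      simp only [m, if_pos h2, hs]
      simp
    · ext s
      change m ((a, 1), s) = _
      have hs : c s 1 = 1 + s := by simp [c]; norm_num
      have := s.2.1
      have h2 : ¬ c s 1 ≤ -1 := by rw [hs]; linarith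
      simp only [m, if_neg h2]
      rw [hs]
      split_ifs with h3
      · have : s = 0 := by ext; simp only [Icc.coe_zero]; linarith
        subst this
        norm_num [h1, trunc_of_ge]
      · simp

/-! ### Points that are neighbourhood deformation retracts -/

/-- Data exhibiting the point `x` as a neighbourhood deformation retract: a function that vanishes
exactly at `x`, and a contraction in `X` of the neighbourhood `{u < 1}` to `x`, fixing `x`.
(The value of `contr` outside `{u < 1}` is irrelevant.) -/
structure NDRPoint {X : Type*} [TopologicalSpace X] (x : X) where
  u : X → ℝ
  contr : X × unitInterval → X
  continuous_u : Continuous u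
  nonneg : ∀ y, 0 ≤ u y
  eq_zero : ∀ y, u y = 0 ↔ y = x
  continuousOn_contr : ContinuousOn contr {p | u p.1 < 1}
  contr_zero : ∀ y, u y < 1 → contr (y, 0) = y
  contr_self : ∀ t, contr (x, t) = x
  contr_one : ∀ y, u y < 1 → contr (y, 1) = x

theorem continuousAt_of_eventually_eq_or {X Z : Type*} [TopologicalSpace X] [TopologicalSpace Z]
    {f g h : X → Z} {x : X} (hg : ContinuousAt g x) (hh : ContinuousAt h x) (hgx : g x = f x)
    (hhx : h x = f x) (hf : ∀ᶠ y in nhds x, f y = g y ∨ f y = h y) : ContinuousAt f x := by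
  intro N hN
  have h1 := hg (show N ∈ nhds (g x) by rwa [hgx])
  have h2 := hh (show N ∈ nhds (h x) by rwa [hhx])
  refine Filter.mem_map.2 ?_
  filter_upwards [h1, h2, hf] with y hy1 hy2 hy3
  obtain e | e := hy3 <;> simp_all

open unitInterval in
/-- The inclusion of a neighbourhood deformation retract `{x}` is a cofibration. Moreover, homotopies
can be extended such that they are constant away from `x`. -/
theorem NDRPoint.exists_extension {X Z : Type*} [TopologicalSpace X] [TopologicalSpace Z] {x : X}
    (N : NDRPoint x) (F : C(X, Z)) (H : C(I, Z)) (hFH : H 0 = F x) :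
    ∃ G : C(X, C(I, Z)), (∀ y, G y 0 = F y) ∧ G x = H ∧ ∀ y s, 1 ≤ N.u y → G y s = F y := by
  obtain ⟨u, c, hu, hu0, hux, hc, hc0, hcx, hc1⟩ := N
  let k (p : X × I) : ℝ := p.2 * (1 - 2 * u p.1)
  let f₁ (p : X × I) : Z := H (trunc (k p - u p.1))
  let f₂ (p : X × I) : Z := F (c (p.1, trunc (k p / u p.1)))
  let m (p : X × I) : Z :=
    if u p.1 ≤ k p then f₁ p else if u p.1 < 3 / 4 then f₂ p else F p.1
  have hk : Continuous k := by fun_prop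
  have hm (p) : u p.1 ≤ k p → m p = f₁ p := fun h => if_pos h
  have hm' (p) (h : k p < u p.1) (h' : u p.1 < 3 / 4) : m p = f₂ p := by
    simp [m, not_le.2 h, h']
  have hfar (p) (h : 1 / 2 ≤ u p.1) : m p = F p.1 := by
    have h1 : k p ≤ 0 := mul_nonpos_of_nonneg_of_nonpos p.2.2.1 (by linarith)
    have h2 : ¬ u p.1 ≤ k p := by linarith
    by_cases h3 : u p.1 < 3 / 4
    · simp only [m, if_neg h2, if_pos h3, f₂]
      rw [trunc_of_le (div_nonpos_of_nonpos_of_nonneg h1 (hu0 _)), hc0 _ (by linarith)]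
    · simp only [m, if_neg h2, if_neg h3]
  have hf₁ : Continuous f₁ := by fun_prop
  have hf₂ (p : X × I) (h0 : u p.1 ≠ 0) (h1 : u p.1 < 3 / 4) : ContinuousAt f₂ p := by
    have ho : IsOpen {q : X × I | u q.1 < 1} := isOpen_lt (by fun_prop) (by fun_prop)
    have h2 : ContinuousAt (fun q : X × I => (q.1, trunc (k q / u q.1))) p := by
      refine continuousAt_fst.prodMk (continuous_projIcc.continuousAt.comp ?_)
      exact hk.continuousAt.div (by fun_prop) h0
    have h3 : ContinuousAt c (p.1, trunc (k p / u p.1)) :=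
      hc.continuousAt (ho.mem_nhds (by simp only [mem_ofPred_eq]; linarith))
    exact F.continuous.continuousAt.comp (ContinuousAt.comp h3 h2)
  have hmc : Continuous m := by
    rw [continuous_iff_continuousAt]
    rintro ⟨y, s⟩
    by_cases hy : 1 / 2 < u y
    · have : m =ᶠ[nhds (y, s)] fun p => F p.1 := by
        filter_upwards [(isOpen_lt (by fun_prop) (by fun_prop) :
          IsOpen {p : X × I | 1 / 2 < u p.1}).mem_nhds hy] with p hp
        exact hfar p hp.le
      exact (ContinuousAt.congr (by fun_prop) this.symm)
    have hy' : u y < 3 / 4 := by linarith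
    have hev : ∀ᶠ p : X × I in nhds (y, s), u p.1 < 3 / 4 :=
      (isOpen_lt (by fun_prop) (by fun_prop) : IsOpen {p : X × I | u p.1 < 3 / 4}).mem_nhds hy'
    obtain h | h | h := lt_trichotomy (u y) (k (y, s))
    · have : m =ᶠ[nhds (y, s)] f₁ := by
        filter_upwards [(isOpen_lt (by fun_prop) (by fun_prop) :
          IsOpen {p : X × I | u p.1 < k p}).mem_nhds h] with p hp
        exact hm p (le_of_lt hp)
      exact hf₁.continuousAt.congr this.symm
    · have hor : ∀ᶠ p in nhds (y, s), m p = f₁ p ∨ m p = f₂ p := by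
        filter_upwards [hev] with p hp
        obtain h' | h' := le_or_gt (u p.1) (k p)
        · exact .inl (hm p h')
        · exact .inr (hm' p h' hp)
      by_cases h0 : u y = 0
      · -- At `(x, 0)` the second formula is not defined, but all its values nearby are close to
        -- `F x` since the contraction fixes `x`.
        obtain rfl := (hux y).1 h0
        have hs : s = 0 := by
          have : k (y, s) = 0 := by rw [← h, h0]
          simpa [k, h0] using this
        subst hs
        have hm0 : m (y, 0) = F y := by
          rw [hm _ h.le]; simp [f₁, k, h0, hFH]
        intro N hN
        rw [hm0] at hN
        have h1 : ∀ᶠ p in nhds (y, (0 : I)), f₁ p ∈ N :=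
          hf₁.continuousAt (by rwa [← hm _ h.le, hm0])
        have h2 : ∀ᶠ p in nhds y, ∀ t : I, F (c (p, t)) ∈ N := by
          have := isCompact_univ.eventually_forall_of_forall_eventually (x₀ := y)
            (P := fun (p : X) (t : I) => F (c (p, t)) ∈ N) (K := univ) fun t _ => by
              have ho : IsOpen {q : X × I | u q.1 < 1} := isOpen_lt (by fun_prop) (by fun_prop)
              have : ContinuousAt c (y, t) := hc.continuousAt (ho.mem_nhds (by simp [h0]))
              exact (F.continuous.continuousAt.comp this) (by simpa [hcx] using hN)
          simpa using this
        refine Filter.mem_map.2 ?_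
        filter_upwards [h1, hor, (continuous_fst.tendsto (y, (0 : I))).eventually h2]
          with p hp1 hp2 hp3
        obtain e | e := hp2
        · simpa [e] using hp1
        · simpa [e] using hp3 _
      · refine continuousAt_of_eventually_eq_or hf₁.continuousAt (hf₂ (y, s) h0 hy')
          (hm _ h.le).symm ?_ hor
        rw [hm _ h.le]
        simp only [f₁, f₂, ← h, sub_self, div_self h0]
        rw [trunc_of_ge le_rfl, trunc_of_le le_rfl, hFH, hc1 _ (by linarith)]
    · have h0 : u y ≠ 0 := by
        intro h0
        rw [h0] at h
        have : (0 : ℝ) ≤ k (y, s) := by simpa [k, h0] using s.2.1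
        linarith
      have : m =ᶠ[nhds (y, s)] f₂ := by
        filter_upwards [hev, (isOpen_lt (by fun_prop) (by fun_prop) :
          IsOpen {p : X × I | k p < u p.1}).mem_nhds h] with p hp hp'
        exact hm' p hp' hp
      exact (hf₂ (y, s) h0 hy').congr this.symm
  refine ⟨ContinuousMap.curry ⟨m, hmc⟩, fun y => ?_, ?_, fun y s hy => hfar (y, s) (by linarith)⟩
  · change m (y, 0) = F y
    by_cases h0 : u y = 0
    · rw [hm _ (by simp [k, h0])]
      obtain rfl := (hux y).1 h0
      simp [f₁, k, h0, hFH]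
    · by_cases h1 : u y < 3 / 4
      · rw [hm' _ (by simpa [k] using (hu0 y).lt_of_ne' h0) h1]
        simp [f₂, k, hc0 y (by linarith)]
      · exact hfar (y, 0) (by simp only; linarith)
  · ext s
    change m (x, s) = H s
    have h0 : u x = 0 := (hux x).2 rfl
    rw [hm _ (by simp [k, h0, s.2.1])]
    simp [f₁, k, h0]

theorem NDRPoint.isCofib {X : Type u} [TopologicalSpace X] {x : X} (N : NDRPoint x) :
    IsCofib (ContinuousMap.const PUnit.{u + 1} x) := by
  intro Z _ F H hFH
  obtain ⟨G, h0, hx, -⟩ := N.exists_extension F (H ⟨⟩) (hFH ⟨⟩)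
  exact ⟨G, h0, fun _ => hx⟩

open unitInterval in
/-- A closed point whose inclusion is a cofibration is a neighbourhood deformation retract. The data
are obtained from a retraction of `X × [0,1]` onto `X × {0} ∪ {x} × [0,1]`. -/
theorem IsCofib.exists_ndrPoint {X : Type u} [TopologicalSpace X] [T1Space X] {x : X}
    (h : IsCofib (ContinuousMap.const PUnit.{u + 1} x)) : Nonempty (NDRPoint x) := by
  obtain ⟨R, hRc, hR0, hRx, hRS⟩ : ∃ R : X → I → X × I, (Continuous fun p : X × I => R p.1 p.2) ∧
      (∀ y, R y 0 = (y, 0)) ∧ (∀ t, R x t = (x, t)) ∧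
        ∀ y t, (R y t).2 = 0 ∨ (R y t).1 = x := by
    obtain ⟨G, hG0, hGx⟩ := h (Z := {p : X × I // p.2 = 0 ∨ p.1 = x})
      ⟨fun y => ⟨(y, 0), .inl rfl⟩, by fun_prop⟩
      (ContinuousMap.const _ ⟨fun t => ⟨(x, t), .inr rfl⟩, by fun_prop⟩) fun _ => rfl
    refine ⟨fun y t => (G y t).1, by fun_prop, fun y => by simp [hG0], fun t => ?_,
      fun y t => (G y t).2⟩
    have := hGx ⟨⟩
    simp only [ContinuousMap.const_apply] at this
    simp [this]
  let d (y : X) (t : I) : ℝ := t - (R y t).2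
  have hd : Continuous ↿d := by
    simp only [d, Function.HasUncurry.uncurry, id]
    fun_prop
  have hbdd (y) : BddAbove (d y '' univ) :=
    isCompact_univ.bddAbove_image (by
      have : Continuous (d y) := hd.comp (by fun_prop : Continuous fun t => (y, t))
      exact this.continuousOn)
  have hle (y t) : d y t ≤ sSup (d y '' univ) := le_csSup (hbdd y) ⟨t, mem_univ t, rfl⟩
  have h0 (y) : 0 ≤ sSup (d y '' univ) := by
    refine le_trans (le_of_eq ?_) (hle y 0)
    simp [d, hR0]
  refine ⟨⟨fun y => sSup (d y '' univ), fun p => (R p.1 p.2).1,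
    isCompact_univ.continuous_sSup hd, h0, fun y => ⟨fun hy => ?_, ?_⟩, ?_, ?_, ?_, ?_⟩⟩
  · -- Every positive time puts `y` on the segment over `x`.
    have h1 (t : I) (ht : t ≠ 0) : (R y t).1 = x := by
      have h2 := hle y t
      rw [hy] at h2
      refine (hRS y t).resolve_left fun h3 => ht ?_
      have h4 : (t : ℝ) ≤ 0 := by simpa [d, h3] using h2
      exact le_antisymm h4 t.2.1
    have hcl : IsClosed {t : I | (R y t).1 = x} :=
      isClosed_singleton.preimage
        (continuous_fst.comp (hRc.comp (by fun_prop : Continuous fun t : I => (y, t))))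
    have hdense : Dense {t : I | t ≠ 0} := dense_compl_singleton 0
    have : (0 : I) ∈ {t : I | (R y t).1 = x} :=
      closure_minimal (fun t ht => h1 t ht) hcl (hdense 0)
    simpa [hR0] using this
  · rintro rfl
    refine le_antisymm (csSup_le (univ_nonempty.image _) ?_) (h0 _)
    rintro _ ⟨t, -, rfl⟩
    simp [d, hRx]
  · exact (by fun_prop : Continuous fun p : X × I => (R p.1 p.2).1).continuousOn
  · intro y _
    simp [hR0]
  · intro t
    simp [hRx]
  · intro y hy
    refine (hRS y 1).resolve_left fun h3 => ?_
    have := (hle y 1).trans_lt hy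
    simp [d, h3] at this

/-- Transport along a homeomorphism. -/
def NDRPoint.ofHomeomorph {X Y : Type*} [TopologicalSpace X] [TopologicalSpace Y] (e : X ≃ₜ Y)
    {x : X} (N : NDRPoint (e x)) : NDRPoint x where
  u y := N.u (e y)
  contr p := e.symm (N.contr (e p.1, p.2))
  continuous_u := N.continuous_u.comp e.continuous
  nonneg y := N.nonneg _
  eq_zero y := by rw [N.eq_zero, e.injective.eq_iff]
  continuousOn_contr := e.symm.continuous.comp_continuousOn
    (N.continuousOn_contr.comp (by fun_prop) fun p hp => hp)
  contr_zero y hy := by rw [N.contr_zero _ hy, e.symm_apply_apply]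
  contr_self t := by rw [N.contr_self, e.symm_apply_apply]
  contr_one y hy := by rw [N.contr_one _ hy, e.symm_apply_apply]

/-! ### Points of finite CW complexes -/

section Ball

variable {E Z : Type*} [NormedAddCommGroup E] [NormedSpace ℝ E] [TopologicalSpace Z]

open unitInterval Metric

/-- The homotopy extension property of the unit ball with respect to the unit sphere. -/
theorem exists_extension_closedBall_sphere {f : E → Z} (hf : ContinuousOn f (closedBall 0 1))
    {g : E × I → Z} (hg : ContinuousOn g (sphere 0 1 ×ˢ univ))
    (hfg : ∀ y ∈ sphere (0 : E) 1, g (y, 0) = f y) :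
    ∃ G : E × I → Z, ContinuousOn G (closedBall 0 1 ×ˢ univ) ∧
      (∀ y ∈ closedBall (0 : E) 1, G (y, 0) = f y) ∧
        ∀ y ∈ sphere (0 : E) 1, ∀ s, G (y, s) = g (y, s) := by
  let c (p : E × I) : ℝ := (1 + p.2) * ‖p.1‖
  have hc : Continuous c := by fun_prop
  let G (p : E × I) : Z :=
    if c p ≤ 1 then f ((1 + p.2 : ℝ) • p.1) else g (‖p.1‖⁻¹ • p.1, trunc (c p - 1))
  have hpos (p : E × I) (h : 1 ≤ c p) : ‖p.1‖ ≠ 0 := by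
    intro h0
    simp only [c, h0, mul_zero] at h
    linarith
  have hsph (p : E × I) (h : 1 ≤ c p) : ‖p.1‖⁻¹ • p.1 ∈ sphere (0 : E) 1 := by
    simp [norm_smul, hpos p h]
  have hG1 : ContinuousOn G {p | c p ≤ 1} := by
    have : ContinuousOn (fun p : E × I => f ((1 + p.2 : ℝ) • p.1)) {p | c p ≤ 1} := by
      refine hf.comp (by fun_prop) fun p hp => ?_
      have h2 : |1 + (p.2 : ℝ)| = 1 + p.2 := abs_of_nonneg (by linarith [p.2.2.1])
      simpa [norm_smul, h2] using hp
    exact this.congr fun p hp => if_pos hp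
  have hG2 : ContinuousOn G {p | 1 ≤ c p} := by
    have : ContinuousOn (fun p : E × I => g (‖p.1‖⁻¹ • p.1, trunc (c p - 1))) {p | 1 ≤ c p} := by
      refine hg.comp (ContinuousOn.prodMk (ContinuousOn.smul (ContinuousOn.inv₀ (by fun_prop) hpos)
        (by fun_prop)) (by fun_prop)) fun p hp => ⟨hsph p hp, mem_univ _⟩
    refine this.congr fun p hp => ?_
    obtain h | h := (show 1 ≤ c p from hp).eq_or_lt
    · have h3 : ‖p.1‖⁻¹ = 1 + (p.2 : ℝ) := by
        rw [inv_eq_iff_eq_inv]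
        exact eq_inv_of_mul_eq_one_right h.symm
      simp only [G, ← h, le_refl, if_true, sub_self]
      rw [trunc_of_le le_rfl, hfg _ (hsph p hp), h3]
    · exact if_neg (not_le.2 h)
  refine ⟨G, ?_, fun y hy => ?_, fun y hy s => ?_⟩
  · refine (hG1.union_of_isClosed hG2 (isClosed_le hc continuous_const)
      (isClosed_le continuous_const hc)).mono fun p _ => le_total (c p) 1
  · have : ‖y‖ ≤ 1 := by simpa using hy
    simp [G, c, this]
  · have hy1 : ‖y‖ = 1 := by simpa using hy
    by_cases hs : (s : ℝ) ≤ 0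
    · have : s = 0 := le_antisymm hs s.2.1
      subst this
      simp [G, c, hy1, hfg y hy]
    · simp [G, c, hy1, hs]

/-- The homotopy extension property of the unit ball with respect to the union of the unit sphere
and an interior point, for homotopies that are constant on the sphere. -/
theorem exists_extension_closedBall_point {f : E → Z} (hf : ContinuousOn f (closedBall 0 1))
    {x : E} (hx : x ∈ ball 0 1) (H : C(I, Z)) (hfH : H 0 = f x) :
    ∃ G : E × I → Z, ContinuousOn G (closedBall 0 1 ×ˢ univ) ∧
      (∀ y ∈ closedBall (0 : E) 1, G (y, 0) = f y) ∧
        (∀ y ∈ sphere (0 : E) 1, ∀ s, G (y, s) = f y) ∧ ∀ s, G (x, s) = H s := by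
  classical
  have hx1 : 0 < 1 - ‖x‖ := by simpa using hx
  have hxc : x ∈ closedBall (0 : E) 1 := ball_subset_closedBall hx
  let N : NDRPoint (⟨x, hxc⟩ : closedBall (0 : E) 1) :=
    { u := fun y => ‖(y : E) - x‖ / (1 - ‖x‖)
      contr := fun p => ⟨(1 - p.2 : ℝ) • (p.1 : E) + (p.2 : ℝ) • x,
        convex_closedBall 0 1 p.1.2 hxc (unitInterval.one_minus_nonneg _) p.2.2.1 (by simp)⟩
      continuous_u := by fun_prop
      nonneg := fun y => by positivity
      eq_zero := fun y => by
        rw [div_eq_zero_iff, or_iff_left hx1.ne', norm_eq_zero, sub_eq_zero, Subtype.ext_iff]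
      continuousOn_contr := Continuous.continuousOn (by fun_prop)
      contr_zero := fun y _ => by simp
      contr_self := fun t => by simp [← add_smul]
      contr_one := fun y _ => by simp }
  obtain ⟨G, hG0, hGx, hGu⟩ := N.exists_extension
    ⟨(closedBall (0 : E) 1).domRestrict f, hf.domRestrict⟩ H hfH
  refine ⟨fun p => if h : p.1 ∈ closedBall (0 : E) 1 then G ⟨p.1, h⟩ p.2 else H 0, ?_, ?_, ?_, ?_⟩
  · rw [continuousOn_iff_continuous_domRestrict]
    have : Continuous fun p : (closedBall (0 : E) 1 ×ˢ univ : Set (E × I)) =>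
        G ⟨p.1.1, p.2.1⟩ p.1.2 := by fun_prop
    refine this.congr fun p => ?_
    simp only [domRestrict_apply, dif_pos p.2.1]
  · intro y hy
    simp only [dif_pos hy, hG0]
    rfl
  · intro y hy s
    have hy' := sphere_subset_closedBall hy
    simp only [dif_pos hy']
    refine hGu _ _ ?_
    have : ‖y‖ = 1 := by simpa using hy
    simp only [N]
    rw [one_le_div hx1, ← this]
    exact norm_sub_norm_le _ _
  · intro s
    simp only [dif_pos hxc, hGx]

end Ball

/-- A map is continuous on a compact image if its composition with the parametrization is. -/
theorem IsCompact.continuousOn_image {X Y Z : Type*} [TopologicalSpace X] [TopologicalSpace Y]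
    [TopologicalSpace Z] [T2Space Y] {K : Set X} (hK : IsCompact K) {φ : X → Y} {g : Y → Z}
    (hφ : ContinuousOn φ K) (hg : ContinuousOn (g ∘ φ) K) : ContinuousOn g (φ '' K) := by
  rw [continuousOn_iff_isClosed]
  intro t ht
  obtain ⟨u, hu, hut⟩ := continuousOn_iff_isClosed.1 hg t ht
  refine ⟨φ '' (K ∩ u), ((hK.inter_right hu).image_of_continuousOn
    (hφ.mono inter_subset_left)).isClosed, ?_⟩
  ext y
  constructor
  · rintro ⟨h1, x, hx, rfl⟩
    have : x ∈ u ∩ K := hut ▸ ⟨h1, hx⟩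
    exact ⟨⟨x, this.symm, rfl⟩, x, hx, rfl⟩
  · rintro ⟨⟨x, hx, rfl⟩, h2⟩
    have : x ∈ g ∘ φ ⁻¹' t ∩ K := hut ▸ hx.symm
    exact ⟨this.1, h2⟩

section CW

open Topology Topology.RelCWComplex Metric unitInterval

variable {X : Type u} [TopologicalSpace X] [CWComplex (univ : Set X)]

variable (X) in
theorem compactSpace_of_finite_CWComplex [CWComplex.Finite (univ : Set X)] : CompactSpace X := by
  have : Finite (Σ n, cell (univ : Set X) n) := finite_cells_of_finite
  refine ⟨?_⟩
  have h := CWComplex.union (C := (univ : Set X))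
  rw [← iUnion_sigma fun p : Σ n, cell (univ : Set X) n => closedCell p.1 p.2] at h
  rw [← h]
  exact isCompact_iUnion fun i => isCompact_closedCell

variable [T2Space X]

/-- A homotopy on the skeleton of cells of dimension `< n` is extended by homotopies on the closed
`n`-cells that agree with it on the boundary. -/
theorem exists_extension_skeletonLT_succ [CWComplex.Finite (univ : Set X)] {Z : Type*}
    [TopologicalSpace Z] (n : ℕ) {G : X × I → Z}
    (hG : ContinuousOn G ((skeletonLT (univ : Set X) n : Set X) ×ˢ univ))
    (E : cell (univ : Set X) n → (Fin n → ℝ) × I → Z)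
    (hE : ∀ i, ContinuousOn (E i) (closedBall 0 1 ×ˢ univ))
    (hGE : ∀ i, ∀ y ∈ sphere (0 : Fin n → ℝ) 1, ∀ s, E i (y, s) = G (map n i y, s)) :
    ∃ G' : X × I → Z, ContinuousOn G' ((skeletonLT (univ : Set X) (n + 1 : ℕ) : Set X) ×ˢ univ) ∧
      (∀ p ∈ (skeletonLT (univ : Set X) n : Set X), ∀ s, G' (p, s) = G (p, s)) ∧
      ∀ i, ∀ y ∈ closedBall (0 : Fin n → ℝ) 1, ∀ s, G' (map n i y, s) = E i (y, s) := by
  classical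
  let G' (p : X × I) : Z := if h : ∃ i, p.1 ∈ openCell (C := univ) n i then
    E h.choose ((map n h.choose).symm p.1, p.2) else G p
  have hG'G (p) (hp : p ∈ (skeletonLT (univ : Set X) n : Set X)) (s) : G' (p, s) = G (p, s) := by
    have : ¬ ∃ i, p ∈ openCell (C := univ) n i := fun ⟨i, hi⟩ =>
      (disjoint_skeletonLT_openCell le_rfl).le_bot ⟨hp, hi⟩
    exact dif_neg this
  have hG'E (i) (y) (hy : y ∈ closedBall (0 : Fin n → ℝ) 1) (s) :
      G' (map n i y, s) = E i (y, s) := by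
    rw [← sphere_union_ball] at hy
    obtain hy | hy := hy
    · rw [hGE i y hy]
      exact hG'G _ (cellFrontier_subset_skeletonLT n i ⟨y, hy, rfl⟩) s
    · have hi : map n i y ∈ openCell (C := univ) n i := ⟨y, hy, rfl⟩
      have h : ∃ i', map n i y ∈ openCell (C := univ) n i' := ⟨i, hi⟩
      have he : h.choose = i := by
        by_contra hne
        refine (disjoint_openCell_of_ne (C := univ) (n := n) (m := n) (i := h.choose) (j := i)
          ?_).le_bot ⟨h.choose_spec, hi⟩
        simpa using hne
      have : G' (map n i y, s) = E h.choose ((map n h.choose).symm (map n i y), s) := dif_pos h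
      rw [this, he, (map n i).left_inv (by rwa [source_eq])]
  refine ⟨G', ?_, hG'G, hG'E⟩
  have hfin : Finite (cell (univ : Set X) n) := FiniteType.finite_cell (D := ∅) n
  have h1 : ContinuousOn G' ((skeletonLT (univ : Set X) n : Set X) ×ˢ univ) :=
    hG.congr fun p hp => hG'G p.1 hp.1 p.2
  have h2 (i : cell (univ : Set X) n) :
      ContinuousOn G' (closedCell n i ×ˢ univ) := by
    have := ((isCompact_closedBall (0 : Fin n → ℝ) 1).prod (isCompact_univ (X := I))
      ).continuousOn_image (φ := Prod.map (map n i) id) (g := G')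
      ((continuousOn n i).prodMap continuousOn_id)
      ((hE i).congr fun p hp => hG'E i p.1 hp.1 p.2)
    rwa [prodMap_image_prod, image_id] at this
  have h3 : ContinuousOn G' (⋃ i : cell (univ : Set X) n, closedCell n i ×ˢ univ) :=
    (locallyFinite_of_finite _).continuousOn_iUnion
      (fun i => isClosed_closedCell.prod isClosed_univ) h2
  have h4 := h1.union_of_isClosed h3 ((skeletonLT (univ : Set X) n).closed.prod isClosed_univ)
    (isClosed_iUnion_of_finite fun i => isClosed_closedCell.prod isClosed_univ)
  have e := skeletonLT_union_iUnion_closedCell_eq_skeletonLT_succ (C := (univ : Set X)) n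
  rw [Nat.cast_add, Nat.cast_one, ← e, union_prod, iUnion_prod_const]
  exact h4

variable (X) in
theorem exists_skeletonLT_eq_univ [CWComplex.Finite (univ : Set X)] :
    ∃ N : ℕ, (skeletonLT (univ : Set X) N : Set X) = univ := by
  obtain ⟨N, hN⟩ := Filter.eventually_atTop.1
    (FiniteDimensional.eventually_isEmpty_cell (C := (univ : Set X)) (D := ∅))
  refine ⟨N, eq_univ_of_forall fun x => ?_⟩
  have hx : x ∈ ⋃ (n : ℕ) (j : cell (univ : Set X) n), openCell n j := by
    rw [CWComplex.iUnion_openCell_eq_complex]; trivial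
  simp only [mem_iUnion] at hx
  obtain ⟨m, j, hj⟩ := hx
  refine CWComplex.mem_skeletonLT_iff.2 ⟨m, ?_, j, hj⟩
  by_contra h
  exact (hN m (by simpa using h)).false j

/-- The inclusion of a point into a finite CW complex is a cofibration: a homotopy of the point is
extended over the open cell that contains it, without moving the boundary of the cell, and then over
all cells of higher dimension. -/
theorem isCofib_const_of_finite_CWComplex [CWComplex.Finite (univ : Set X)] (x : X) :
    IsCofib (ContinuousMap.const PUnit.{u + 1} x) := by
  classical
  intro Z _ F H' hFH'
  obtain ⟨H, rfl⟩ : ∃ H : C(I, Z), ContinuousMap.const PUnit.{u + 1} H = H' := ⟨H' ⟨⟩, rfl⟩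
  have hFH : H 0 = F x := hFH' ⟨⟩
  have key (n : ℕ) : ∃ G : X × I → Z,
      ContinuousOn G ((skeletonLT (univ : Set X) n : Set X) ×ˢ univ) ∧
      (∀ p ∈ (skeletonLT (univ : Set X) n : Set X), G (p, 0) = F p) ∧
      (x ∈ (skeletonLT (univ : Set X) n : Set X) → ∀ s, G (x, s) = H s) ∧
      (x ∉ (skeletonLT (univ : Set X) n : Set X) →
        ∀ p ∈ (skeletonLT (univ : Set X) n : Set X), ∀ s, G (p, s) = F p) := by
    induction n with
    | zero =>
      have : (skeletonLT (univ : Set X) ((0 : ℕ) : ℕ∞) : Set X) = ∅ :=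
        CWComplex.skeletonLT_zero_eq_empty
      exact ⟨fun p => F p.1, by fun_prop, by simp, fun h => (this.le h).elim, by simp⟩
    | succ n ih =>
      obtain ⟨G, hGc, hG0, hGx, hGF⟩ := ih
      have hfr (i : cell (univ : Set X) n) (y) (hy : y ∈ sphere (0 : Fin n → ℝ) 1) :
          map n i y ∈ (skeletonLT (univ : Set X) n : Set X) :=
        cellFrontier_subset_skeletonLT n i ⟨y, hy, rfl⟩
      have hFΦ (i : cell (univ : Set X) n) : ContinuousOn (fun y => F (map n i y)) (closedBall 0 1) :=
        F.continuous.comp_continuousOn (continuousOn n i)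
      have hcell (i : cell (univ : Set X) n) : ∃ E : (Fin n → ℝ) × I → Z,
          ContinuousOn E (closedBall 0 1 ×ˢ univ) ∧
          (∀ y ∈ closedBall (0 : Fin n → ℝ) 1, E (y, 0) = F (map n i y)) ∧
          (∀ y ∈ sphere (0 : Fin n → ℝ) 1, ∀ s, E (y, s) = G (map n i y, s)) ∧
          (∀ y ∈ ball (0 : Fin n → ℝ) 1, map n i y = x → ∀ s, E (y, s) = H s) ∧
          (x ∉ (skeletonLT (univ : Set X) (n + 1 : ℕ) : Set X) →
            ∀ y ∈ closedBall (0 : Fin n → ℝ) 1, ∀ s, E (y, s) = F (map n i y)) := by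
        by_cases hx : x ∈ (skeletonLT (univ : Set X) n : Set X)
        · obtain ⟨E, h1, h2, h3⟩ := exists_extension_closedBall_sphere (hFΦ i)
            (g := fun p => G (map n i p.1, p.2))
            (hGc.comp (((continuousOn n i).mono sphere_subset_closedBall).prodMap continuousOn_id)
              fun p hp => ⟨hfr i _ hp.1, mem_univ _⟩) fun y hy => hG0 _ (hfr i y hy)
          refine ⟨E, h1, h2, h3, fun y hy hyx => ?_, fun h => ?_⟩
          · exact ((disjoint_skeletonLT_openCell (j := i) le_rfl).le_bot ⟨hx, y, hy, hyx⟩).elim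
          · exact (h (skeletonLT_mono (by simp) hx)).elim
        · by_cases hxi : x ∈ openCell n i
          · obtain ⟨y₀, hy₀, rfl⟩ := hxi
            obtain ⟨E, h1, h2, h3, h4⟩ := exists_extension_closedBall_point (hFΦ i) hy₀ H hFH
            refine ⟨E, h1, h2, fun y hy s => ?_, fun y hy hyx => ?_, fun h => ?_⟩
            · rw [h3 y hy, hGF hx _ (hfr i y hy)]
            · rw [(map n i).injOn (by rwa [source_eq]) (by rwa [source_eq]) hyx]
              exact h4
            · exact (h (openCell_subset_skeletonLT n i ⟨y₀, hy₀, rfl⟩)).elim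
          · refine ⟨fun p => F (map n i p.1), (hFΦ i).comp continuousOn_fst fun p hp => hp.1,
              fun _ _ => rfl, fun y hy s => ?_, fun y hy hyx => ?_, fun _ _ _ _ => rfl⟩
            · rw [hGF hx _ (hfr i y hy)]
            · exact (hxi ⟨y, hy, hyx⟩).elim
      choose E hE hE0 hES hEx hEF using hcell
      obtain ⟨G', hG', hG'G, hG'E⟩ := exists_extension_skeletonLT_succ n hGc E hE hES
      have hsucc (p) (hp : p ∈ (skeletonLT (univ : Set X) (n + 1 : ℕ) : Set X)) :
          p ∈ (skeletonLT (univ : Set X) n : Set X) ∨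
            ∃ i, ∃ y ∈ closedBall (0 : Fin n → ℝ) 1, map (C := univ) n i y = p := by
        rw [Nat.cast_add, Nat.cast_one, ← skeletonLT_union_iUnion_closedCell_eq_skeletonLT_succ]
          at hp
        obtain hp | hp := hp
        · exact .inl hp
        · exact .inr (by simpa [closedCell] using hp)
      refine ⟨G', hG', fun p hp => ?_, fun hx s => ?_, fun hx p hp s => ?_⟩
      · obtain hp | ⟨i, y, hy, rfl⟩ := hsucc p hp
        · rw [hG'G p hp, hG0 p hp]
        · rw [hG'E i y hy, hE0 i y hy]
      · obtain hp | ⟨i, y, hy, hyx⟩ := hsucc x hx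
        · rw [hG'G x hp, hGx hp]
        · rw [← sphere_union_ball] at hy
          obtain hy | hy := hy
          · have hp := hfr i y hy
            rw [hyx] at hp
            rw [hG'G x hp, hGx hp]
          · rw [← hEx i y hy hyx s, ← hyx, hG'E i y (ball_subset_closedBall hy)]
      · obtain hp | ⟨i, y, hy, rfl⟩ := hsucc p hp
        · rw [hG'G p hp, hGF (fun h => hx (skeletonLT_mono (by simp) h)) p hp]
        · rw [hG'E i y hy, hEF i hx y hy]
  obtain ⟨N, hN⟩ := exists_skeletonLT_eq_univ X
  obtain ⟨G, hGc, hG0, hGx, -⟩ := key N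
  rw [hN, univ_prod_univ, continuousOn_univ] at hGc
  rw [hN] at hG0 hGx
  refine ⟨ContinuousMap.curry ⟨G, hGc⟩, fun y => hG0 y trivial, fun _ => ?_⟩
  ext s
  exact hGx trivial s

theorem exists_ndrPoint_of_finite_CWComplex [CWComplex.Finite (univ : Set X)] (x : X) :
    Nonempty (NDRPoint x) :=
  IsCofib.exists_ndrPoint (isCofib_const_of_finite_CWComplex x)

end CW

/-! ### Joins of finite families -/

open scoped unitInterval

namespace stdSimplex

variable {V : Type*} [Fintype V]

/-- The point with parameter `s` on the segment from `t` to `t'`. -/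
noncomputable def mix (s : I) (t t' : stdSimplex ℝ V) : stdSimplex ℝ V :=
  ⟨(1 - s : ℝ) • t.1 + (s : ℝ) • t'.1, convex_stdSimplex ℝ V t.2 t'.2
    (unitInterval.one_minus_nonneg s) s.2.1 (by simp)⟩

theorem mix_apply (s : I) (t t' : stdSimplex ℝ V) (i : V) :
    (mix s t t').1 i = (1 - s) * t.1 i + s * t'.1 i := rfl

@[simp] theorem mix_zero (t t' : stdSimplex ℝ V) : mix 0 t t' = t := by
  apply Subtype.ext; funext i; simp [mix_apply]

@[simp] theorem mix_one (t t' : stdSimplex ℝ V) : mix 1 t t' = t' := by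
  apply Subtype.ext; funext i; simp [mix_apply]

@[simp] theorem mix_self (s : I) (t : stdSimplex ℝ V) : mix s t t = t := by
  apply Subtype.ext; funext i; simp only [mix_apply]; ring

@[fun_prop]
theorem continuous_mix {Y : Type*} [TopologicalSpace Y] {a : Y → I} {b c : Y → stdSimplex ℝ V}
    (ha : Continuous a) (hb : Continuous b) (hc : Continuous c) :
    Continuous fun y => mix (a y) (b y) (c y) := by
  unfold mix
  fun_prop

theorem continuous_coord {Y : Type*} [TopologicalSpace Y] {b : Y → stdSimplex ℝ V}
    (hb : Continuous b) (i : V) : Continuous fun y => (b y).1 i :=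
  (continuous_apply i).comp (continuous_subtype_val.comp hb)

theorem ne_zero_of_mix_ne_zero {s : I} {t t' : stdSimplex ℝ V} {i : V}
    (h : (mix s t t').1 i ≠ 0) : t.1 i ≠ 0 ∨ t'.1 i ≠ 0 := by
  by_contra! h'
  simp [mix_apply, h'] at h

theorem exists_ne_zero (t : stdSimplex ℝ V) : ∃ i, t.1 i ≠ 0 := by
  by_contra! h
  have := t.2.2
  simp [h] at this

variable [DecidableEq V]

theorem vertex_ne_zero {v i : V} (h : (vertex (S := ℝ) v).1 i ≠ 0) : i = v := by
  by_contra hne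
  exact h (by simp [hne])

@[simp] theorem vertex_self (v : V) : (vertex (S := ℝ) v).1 v = 1 := by simp

theorem eq_vertex_of_eq_one {t : stdSimplex ℝ V} {v : V} (h : t.1 v = 1) : t = vertex v := by
  have h1 := t.2.2
  rw [← Finset.add_sum_erase _ _ (Finset.mem_univ v), h, add_eq_left,
    Finset.sum_eq_zero_iff_of_nonneg fun i _ => t.2.1 i] at h1
  apply Subtype.ext
  funext i
  by_cases hi : i = v
  · subst hi; simp [h]
  · rw [h1 i (by simp [hi])]
    simp [hi]

/-- Every point other than the vertex `v` lies on a segment from a point of the opposite face to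
`v`. -/
theorem exists_mix_vertex_eq (t : stdSimplex ℝ V) (v : V) (h : t.1 v ≠ 1) :
    ∃ (s : I) (t' : stdSimplex ℝ V), mix s t' (vertex v) = t ∧
      ∀ i, t'.1 i ≠ 0 → t.1 i ≠ 0 ∧ i ≠ v := by
  have hle : t.1 v ≤ 1 := t.2.2 ▸ Finset.single_le_sum (fun i _ => t.2.1 i) (Finset.mem_univ v)
  have hpos : 0 < 1 - t.1 v := sub_pos.2 (lt_of_le_of_ne hle h)
  have hsum : ∑ i, Function.update t.1 v 0 i = 1 - t.1 v := by
    have h1 := t.2.2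
    rw [← Finset.add_sum_erase _ _ (Finset.mem_univ v)] at h1 ⊢
    rw [Function.update_self, zero_add, ← h1, add_sub_cancel_left]
    exact Finset.sum_congr rfl fun i hi => Function.update_of_ne (Finset.ne_of_mem_erase hi) _ _
  refine ⟨⟨t.1 v, t.2.1 v, hle⟩, ⟨fun i => Function.update t.1 v 0 i / (1 - t.1 v), fun i => ?_, ?_⟩,
    ?_, fun i hi => ?_⟩
  · refine div_nonneg ?_ hpos.le
    by_cases hi : i = v
    · subst hi; simp
    · rw [Function.update_of_ne hi]; exact t.2.1 i
  · rw [← Finset.sum_div, hsum, div_self hpos.ne']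
  · apply Subtype.ext
    funext i
    rw [mix_apply]
    simp only
    rw [mul_div_cancel₀ _ hpos.ne']
    by_cases hi : i = v
    · subst hi; simp
    · simp [hi]
  · by_cases hiv : i = v
    · subst hiv; simp at hi
    · refine ⟨fun h0 => hi ?_, hiv⟩
      simp [hiv, h0]

end stdSimplex

namespace FamilyJoin

open stdSimplex

variable {V : Type u} [Fintype V] {X : V → Type v}

/-- The barycentric coordinates of a point of the join. -/
def weight (z : FamilyJoin X) : stdSimplex ℝ V :=
  Quotient.lift (fun p : JoinRep X => p.2.1.1) (fun p q (h : (joinSetoid X).r p q) => h.1) z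

/-- The formal convex combination of points `x i` with coefficients `t i`. -/
def mk (p : stdSimplex ℝ V × ∀ i, X i) : FamilyJoin X :=
  Quotient.mk (joinSetoid X) ⟨Finset.univ, ⟨p.1, fun i hi => (hi (Finset.mem_univ i)).elim⟩,
    fun i => p.2 i⟩

@[simp] theorem weight_mk (p : stdSimplex ℝ V × ∀ i, X i) : (mk p).weight = p.1 := rfl

theorem mk_eq_mk {p q : stdSimplex ℝ V × ∀ i, X i} :
    mk p = mk q ↔ p.1 = q.1 ∧ ∀ i, p.1.1 i ≠ 0 → p.2 i = q.2 i := by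
  refine Quotient.eq.trans ⟨fun h => ⟨h.1, fun i hi => h.2 i (Finset.mem_univ i)
    (Finset.mem_univ i) hi⟩, fun h => ⟨h.1, fun i _ _ hi => h.2 i hi⟩⟩

open scoped Classical in
/-- The set of indices with nonzero barycentric coordinate. -/
noncomputable def support (z : FamilyJoin X) : Finset V := {i | z.weight.1 i ≠ 0}

@[simp] theorem mem_support {z : FamilyJoin X} {i : V} : i ∈ z.support ↔ z.weight.1 i ≠ 0 := by
  simp [support]

theorem support_nonempty (z : FamilyJoin X) : z.support.Nonempty := by
  obtain ⟨i, hi⟩ := exists_ne_zero z.weight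
  exact ⟨i, mem_support.2 hi⟩

theorem mk_surjective [∀ i, Nonempty (X i)] : Function.Surjective (mk (X := X)) := by
  classical
  rintro ⟨τ, t, x⟩
  refine ⟨(t.1, fun i => if h : i ∈ τ then x ⟨i, h⟩ else Classical.arbitrary _), ?_⟩
  refine Quotient.sound ⟨rfl, fun i _ hi _ => dif_pos hi⟩

theorem mem_polyhedralJoin_iff [∀ i, Nonempty (X i)] {K : PreAbstractSimplicialComplex V}
    {z : FamilyJoin X} : z ∈ polyhedralJoin X K ↔ z.support ∈ K := by
  classical
  constructor
  · intro h
    simp only [polyhedralJoin, mem_iUnion] at h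
    obtain ⟨τ, hτ, p, hp, rfl⟩ := h
    refine (K.isRelLowerSet_faces hτ).2 (fun i hi => ?_) (support_nonempty _)
    have hi' : p.2.1.1.1 i ≠ 0 := mem_support.1 hi
    have hip : i ∈ p.1 := by
      by_contra h
      exact hi' (p.2.1.2 i h)
    have := hp ⟨i, hip⟩
    by_contra hiτ
    simp [hiτ] at this
  · intro h
    obtain ⟨⟨t, x⟩, rfl⟩ := mk_surjective z
    simp only [polyhedralJoin, mem_iUnion]
    refine ⟨_, h, ⟨(mk (t, x)).support, ⟨t, fun i hi => ?_⟩, fun i => x i⟩, fun i => ?_, ?_⟩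
    · simpa using hi
    · simp
    · exact Quotient.sound ⟨rfl, fun _ _ _ _ => rfl⟩

/-- The point `x i` of a formal convex combination. If the coefficient of `i` vanishes, this is
some point of `X i`. -/
noncomputable def point [∀ i, Nonempty (X i)] (z : FamilyJoin X) (i : V) : X i :=
  (mk_surjective z).choose.2 i

@[simp] theorem mk_weight_point [∀ i, Nonempty (X i)] (z : FamilyJoin X) :
    mk (z.weight, z.point) = z := by
  have h := (mk_surjective z).choose_spec
  have hw : z.weight = (mk_surjective z).choose.1 := by
    conv_lhs => rw [← h]
    rfl
  rw [hw]
  exact h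

theorem point_mk [∀ i, Nonempty (X i)] {t : stdSimplex ℝ V} {x : ∀ i, X i} {i : V}
    (hi : t.1 i ≠ 0) : (mk (t, x)).point i = x i := by
  have := mk_eq_mk.1 (mk_weight_point (mk (t, x)))
  exact this.2 i hi

variable [∀ i, TopologicalSpace (X i)]

@[fun_prop]
theorem continuous_mk : Continuous (mk (X := X)) := by
  have h1 : Continuous fun q : {t : stdSimplex ℝ V // ∀ i, i ∉ Finset.univ → t.1 i = 0} ×
      ((i : (Finset.univ : Finset V)) → X i) => (⟨Finset.univ, q⟩ : JoinRep X) :=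
    @continuous_sigmaMk _ (fun τ : Finset V =>
      {t : stdSimplex ℝ V // ∀ i, i ∉ τ → t.1 i = 0} × ((i : τ) → X i)) _ Finset.univ
  have h2 : Continuous fun p : stdSimplex ℝ V × ∀ i, X i =>
      ((⟨p.1, fun i hi => (hi (Finset.mem_univ i)).elim⟩, fun i => p.2 i) :
        {t : stdSimplex ℝ V // ∀ i, i ∉ Finset.univ → t.1 i = 0} ×
          ((i : (Finset.univ : Finset V)) → X i)) := by fun_prop
  exact (continuous_quotient_mk' (s := joinSetoid X)).comp (h1.comp h2)

@[fun_prop]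
theorem continuous_weight : Continuous (weight (X := X)) := by
  refine continuous_quot_lift (r := (joinSetoid X).r) _ ?_
  exact continuous_sigma fun τ => continuous_subtype_val.comp continuous_fst

/-- The set of formal convex combinations whose `i`-th coefficient is nonzero and whose `i`-th point
lies in a given open set is open. -/
theorem isOpen_setOf_point_mem [∀ i, Nonempty (X i)] (i : V) {U : Set (X i)} (hU : IsOpen U) :
    IsOpen {z : FamilyJoin X | z.weight.1 i ≠ 0 ∧ z.point i ∈ U} := by
  classical
  refine isOpen_coinduced.2 (isOpen_sigma_iff.2 fun τ => ?_)
  by_cases hi : i ∈ τ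
  · have : IsOpen {p : {t : stdSimplex ℝ V // ∀ i, i ∉ τ → t.1 i = 0} × ((i : τ) → X i) |
        p.1.1.1 i ≠ 0 ∧ p.2 ⟨i, hi⟩ ∈ U} :=
      (isOpen_ne_fun (continuous_coord (continuous_subtype_val.comp continuous_fst) i)
        continuous_const).inter (hU.preimage (by fun_prop))
    convert this using 1
    ext p
    refine and_congr_right fun hp => ?_
    have : (Quotient.mk (joinSetoid X) ⟨τ, p⟩ : FamilyJoin X) =
        mk (p.1.1, fun i => if h : i ∈ τ then p.2 ⟨i, h⟩ else Classical.arbitrary _) :=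
      Quotient.sound ⟨rfl, fun j hj _ _ => by simp only at hj; simp [hj]⟩
    change point (Quotient.mk (joinSetoid X) ⟨τ, p⟩ : FamilyJoin X) i ∈ U ↔ _
    rw [this, point_mk (t := p.1.1) hp, dif_pos hi]
  · convert isOpen_empty
    ext p
    exact ⟨fun h => h.1 (p.1.2 i hi), fun h => h.elim⟩

instance [∀ i, Nonempty (X i)] [∀ i, T2Space (X i)] : T2Space (FamilyJoin X) := by
  refine ⟨fun z z' hne => ?_⟩
  by_cases hw : z.weight = z'.weight
  · obtain ⟨i, hi, hx⟩ : ∃ i, z.weight.1 i ≠ 0 ∧ z.point i ≠ z'.point i := by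
      by_contra! h
      refine hne ?_
      rw [← mk_weight_point z, ← mk_weight_point z']
      exact mk_eq_mk.2 ⟨hw, h⟩
    obtain ⟨U, U', hU, hU', hz, hz', hd⟩ := t2_separation hx
    refine ⟨_, _, isOpen_setOf_point_mem i hU, isOpen_setOf_point_mem i hU', ⟨hi, hz⟩,
      ⟨hw ▸ hi, hz'⟩, ?_⟩
    rw [Set.disjoint_left] at hd ⊢
    exact fun y hy hy' => hd hy.2 hy'.2
  · obtain ⟨U, U', hU, hU', hz, hz', hd⟩ := t2_separation hw
    exact ⟨_, _, hU.preimage continuous_weight, hU'.preimage continuous_weight, hz, hz',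
      hd.preimage _⟩

variable [∀ i, Nonempty (X i)]

theorem isClosed_polyhedralJoin (K : PreAbstractSimplicialComplex V) :
    IsClosed (polyhedralJoin X K) := by
  have : polyhedralJoin X K =
      ⋃ τ : {τ // τ ∈ K}, {z : FamilyJoin X | ∀ i, i ∉ τ.1 → z.weight.1 i = 0} := by
    ext z
    rw [mem_polyhedralJoin_iff, mem_iUnion]
    refine ⟨fun h => ⟨⟨_, h⟩, fun i hi => by simpa using hi⟩, fun ⟨τ, hτ⟩ => ?_⟩
    refine (K.isRelLowerSet_faces τ.2).2 (fun i hi => ?_) (support_nonempty _)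
    by_contra h
    exact mem_support.1 hi (hτ i h)
  rw [this]
  refine isClosed_iUnion_of_finite fun τ => ?_
  simp only [ofPred_forall]
  exact isClosed_iInter fun i => isClosed_iInter fun _ =>
    isClosed_eq (continuous_coord continuous_weight i) continuous_const

variable [∀ i, CompactSpace (X i)]

instance : CompactSpace (FamilyJoin X) := by
  refine ⟨?_⟩
  rw [← mk_surjective.range_eq]
  exact isCompact_range continuous_mk

variable [∀ i, T2Space (X i)]

/-- Up to a compact parameter, the join is a quotient of `Δ × ∏ᵢ Xᵢ`. -/
theorem isQuotientMap_mk_prodMap_id (Y : Type*) [TopologicalSpace Y] [CompactSpace Y] [T2Space Y] :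
    Topology.IsQuotientMap (Prod.map (mk (X := X)) (id : Y → Y)) :=
  .of_surjective_continuous (mk_surjective.prodMap Function.surjective_id)
    (continuous_mk.prodMap continuous_id)

instance (K : PreAbstractSimplicialComplex V) : CompactSpace (polyhedralJoin X K) :=
  isCompact_iff_compactSpace.1 (isClosed_polyhedralJoin K).isCompact

/-! ### Points of polyhedral joins are neighbourhood deformation retracts -/

/-- If all points of the spaces `X i` are neighbourhood deformation retracts, then so are the points
of their join. The contraction moves barycentric coordinates along segments, so that it does not
enlarge supports. -/
theorem exists_ndrPoint (hX : ∀ i (x : X i), Nonempty (NDRPoint x)) (z : FamilyJoin X) :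
    ∃ N : NDRPoint z, ∀ y s, N.u y < 1 → (N.contr (y, s)).support ⊆ y.support := by
  classical
  obtain ⟨⟨t₀, x₀⟩, rfl⟩ := mk_surjective z
  have N i : NDRPoint (x₀ i) := (hX i (x₀ i)).some
  -- `δ` is a positive lower bound for the nonzero barycentric coordinates of `z`.
  obtain ⟨δ, hδ, hδt⟩ : ∃ δ : ℝ, 0 < δ ∧ ∀ i, t₀.1 i ≠ 0 → δ ≤ t₀.1 i := by
    obtain ⟨i, hi, hmin⟩ := Finset.exists_min_image _ t₀.1 (support_nonempty (mk (t₀, x₀)))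
    rw [mem_support] at hi
    exact ⟨t₀.1 i, lt_of_le_of_ne (t₀.2.1 i) hi.symm, fun j hj => hmin j (mem_support.2 hj)⟩
  let a (i : V) (z : FamilyJoin X) : ℝ := z.weight.1 i * (N i).u (z.point i)
  have ha_mk (i t x) : a i (mk (t, x)) = t.1 i * (N i).u (x i) := by
    by_cases h : t.1 i = 0
    · simp [a, h]
    · simp [a, point_mk h]
  have ha (i) : Continuous (a i) := by
    rw [(Topology.IsQuotientMap.of_surjective_continuous mk_surjective
      (continuous_mk (X := X))).continuous_iff]
    have h := (N i).continuous_u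
    exact ((continuous_coord continuous_fst i).mul
      (h.comp (by fun_prop : Continuous fun p : stdSimplex ℝ V × ∀ i, X i => p.2 i))).congr
        fun p => (ha_mk i p.1 p.2).symm
  have ha0 (i z) : 0 ≤ a i z := mul_nonneg (z.weight.2.1 i) ((N i).nonneg _)
  let b (i : V) (z : FamilyJoin X) : ℝ :=
    |t₀.1 i - z.weight.1 i| + if t₀.1 i ≠ 0 then a i z else 0
  have hb0 (i z) : 0 ≤ b i z := by
    refine add_nonneg (abs_nonneg _) ?_
    split_ifs
    exacts [ha0 i z, le_rfl]
  have hb (i) : Continuous (b i) := by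
    have h : Continuous fun z : FamilyJoin X => |t₀.1 i - z.weight.1 i| :=
      (continuous_const.sub (continuous_coord continuous_weight i)).abs
    by_cases hi : t₀.1 i ≠ 0
    · simp only [b, if_pos hi]
      exact h.add (ha i)
    · simp only [b, if_neg hi]
      exact h.add continuous_const
  let u (z : FamilyJoin X) : ℝ := (∑ i, b i z) / (δ / 2)
  have hu : Continuous u := (continuous_finsetSum _ fun i _ => hb i).div_const _
  -- Near `z` all indices in the support of `z` have a nonzero coefficient and a point that lies in
  -- the neighbourhood contracted by `N i`.
  have hbu (i z) (hz : u z < 1) : b i z < δ / 2 := by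
    rw [div_lt_one (by positivity)] at hz
    exact (Finset.single_le_sum (fun j _ => hb0 j z) (Finset.mem_univ i)).trans_lt hz
  have hw (i z) (hz : u z < 1) (hi : t₀.1 i ≠ 0) : δ / 2 < z.weight.1 i := by
    have h1 := hbu i z hz
    simp only [b, if_pos hi] at h1
    have h2 := ha0 i z
    have h3 := le_abs_self (t₀.1 i - z.weight.1 i)
    have h4 := hδt i hi
    linarith
  have hw0 (i z) (hz : u z < 1) (hi : t₀.1 i ≠ 0) : z.weight.1 i ≠ 0 :=
    ((half_pos hδ).trans (hw i z hz hi)).ne'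
  have huN (i) (z : FamilyJoin X) (hz : u z < 1) (hi : t₀.1 i ≠ 0) : (N i).u (z.point i) < 1 := by
    have h1 := hbu i z hz
    simp only [b, if_pos hi] at h1
    have h2 := hw i z hz hi
    have h3 := abs_nonneg (t₀.1 i - z.weight.1 i)
    by_contra! h4
    have h5 : z.weight.1 i ≤ a i z := le_mul_of_one_le_right (z.weight.2.1 i) h4
    linarith
  let cx (x : ∀ i, X i) (s : I) (i : V) : X i :=
    if t₀.1 i ≠ 0 then (N i).contr (x i, s) else x i
  let c (p : FamilyJoin X × I) : FamilyJoin X := mk (mix p.2 p.1.weight t₀, cx p.1.point p.2)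
  have hc_mk (t x s) (h : u (mk (t, x)) < 1) : c (mk (t, x), s) = mk (mix s t t₀, cx x s) := by
    refine mk_eq_mk.2 ⟨rfl, fun i hi => ?_⟩
    have hti : t.1 i ≠ 0 := by
      obtain h1 | h1 := ne_zero_of_mix_ne_zero hi
      · exact h1
      · exact hw0 i _ h h1
    simp only [cx, point_mk hti]
  have hz_eq (z : FamilyJoin X) (hz : z.weight = t₀)
      (hx : ∀ i, t₀.1 i ≠ 0 → z.point i = x₀ i) : z = mk (t₀, x₀) := by
    rw [← mk_weight_point z]
    exact mk_eq_mk.2 ⟨hz, fun i hi => hx i (hz ▸ hi)⟩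
  refine ⟨⟨u, c, hu, fun z => div_nonneg (Finset.sum_nonneg fun i _ => hb0 i z) (by positivity),
    fun z => ⟨fun hz => ?_, ?_⟩, ?_, fun z hz => ?_, fun s => ?_, fun z hz => ?_⟩, fun z s hz => ?_⟩
  · have hbz (i) : b i z = 0 := by
      rw [div_eq_zero_iff, or_iff_left (by positivity),
        Finset.sum_eq_zero_iff_of_nonneg fun i _ => hb0 i z] at hz
      exact hz i (Finset.mem_univ i)
    have hwz : z.weight = t₀ := by
      apply Subtype.ext
      funext i
      have h1 := hbz i
      have h2 : 0 ≤ if t₀.1 i ≠ 0 then a i z else 0 := by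
        split_ifs
        exacts [ha0 i z, le_rfl]
      have h3 : |t₀.1 i - z.weight.1 i| = 0 := le_antisymm (by simp only [b] at h1; linarith)
        (abs_nonneg _)
      linarith [abs_eq_zero.1 h3]
    refine hz_eq z hwz fun i hi => ?_
    have h1 := hbz i
    simp only [b, hwz, sub_self, abs_zero, zero_add, if_pos hi, a] at h1
    exact ((N i).eq_zero _).1 ((mul_eq_zero.1 h1).resolve_left hi)
  · rintro rfl
    have h (i) : b i (mk (t₀, x₀)) = 0 := by simp [b, ha_mk, ((N i).eq_zero _).2]
    simp [u, h]
  · have ho : IsOpen {p : FamilyJoin X × I | u p.1 < 1} := isOpen_lt (by fun_prop) (by fun_prop)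
    refine ((isQuotientMap_mk_prodMap_id I).continuousOn_isOpen_iff ho).2 ?_
    have h1 : ContinuousOn (fun p : (stdSimplex ℝ V × ∀ i, X i) × I =>
        mk (mix p.2 p.1.1 t₀, cx p.1.2 p.2)) (Prod.map mk id ⁻¹' {p | u p.1 < 1}) := by
      refine continuous_mk.comp_continuousOn (ContinuousOn.prodMk (by fun_prop) ?_)
      refine continuousOn_pi.2 fun i => ?_
      by_cases hi : t₀.1 i = 0
      · simp only [cx, hi, ne_eq, not_true_eq_false, if_false]
        fun_prop
      · simp only [cx, ne_eq, hi, not_false_eq_true, if_true]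
        refine (N i).continuousOn_contr.comp (by fun_prop) fun p hp => ?_
        have h2 := huN i _ hp hi
        have h3 := hw0 i _ hp hi
        rw [Prod.map_fst, weight_mk] at h3
        rwa [Prod.map_fst, point_mk h3] at h2
    exact h1.congr fun p hp => hc_mk p.1.1 p.1.2 p.2 hp
  · conv_rhs => rw [← mk_weight_point z]
    simp only [c, mix_zero]
    congr 2
    funext i
    by_cases hi : t₀.1 i = 0
    · simp [cx, hi]
    · simp only [cx, ne_eq, hi, not_false_eq_true, if_true]
      exact (N i).contr_zero _ (huN i z hz hi)
  · have h (i) : b i (mk (t₀, x₀)) = 0 := by simp [b, ha_mk, ((N i).eq_zero _).2]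
    rw [hc_mk _ _ _ (by simp [u, h]), mix_self]
    refine mk_eq_mk.2 ⟨rfl, fun i hi => ?_⟩
    simp only at hi
    simp [cx, hi, (N i).contr_self]
  · simp only [c, mix_one]
    refine mk_eq_mk.2 ⟨rfl, fun i hi => ?_⟩
    simp only at hi
    simp only [cx, ne_eq, hi, not_false_eq_true, if_true]
    exact (N i).contr_one _ (huN i z hz hi)
  · intro i hi
    rw [mem_support] at hi ⊢
    obtain h1 | h1 := ne_zero_of_mix_ne_zero hi
    · exact h1
    · exact hw0 i z hz h1

theorem exists_ndrPoint_polyhedralJoin (hX : ∀ i (x : X i), Nonempty (NDRPoint x))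
    (K : PreAbstractSimplicialComplex V) (z : polyhedralJoin X K) : Nonempty (NDRPoint z) := by
  classical
  obtain ⟨N, hN⟩ := exists_ndrPoint hX z.1
  have hmem (y : polyhedralJoin X K) (s) (hy : N.u y < 1) :
      N.contr (y, s) ∈ polyhedralJoin X K :=
    mem_polyhedralJoin_iff.2 ((K.isRelLowerSet_faces (mem_polyhedralJoin_iff.1 y.2)).2
      (hN y s hy) (support_nonempty _))
  refine ⟨⟨fun y => N.u y, fun p => if h : N.u p.1 < 1 then ⟨N.contr (p.1, p.2), hmem p.1 p.2 h⟩
    else p.1, N.continuous_u.comp continuous_subtype_val, fun y => N.nonneg _, fun y => ?_, ?_, ?_,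
    ?_, ?_⟩⟩
  · rw [N.eq_zero, Subtype.ext_iff]
  · rw [Topology.IsEmbedding.subtypeVal.continuousOn_iff]
    have : ContinuousOn (fun p : polyhedralJoin X K × I => N.contr (p.1, p.2))
        {p | N.u p.1 < 1} := N.continuousOn_contr.comp (by fun_prop) fun p hp => hp
    refine this.congr fun p hp => ?_
    simp only [Function.comp, dif_pos (show N.u p.1 < 1 from hp)]
  · intro y hy
    simp only [dif_pos hy]
    exact Subtype.ext (N.contr_zero _ hy)
  · intro s
    have h : N.u z < 1 := by rw [(N.eq_zero _).2 rfl]; exact one_pos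
    simp only [dif_pos h]
    exact Subtype.ext (N.contr_self _)
  · intro y hy
    simp only [dif_pos hy]
    exact Subtype.ext (N.contr_one _ hy)

end FamilyJoin

/-! ### Wedge sums and suspensions as pushouts -/

namespace Wedge

variable {X Y : Type u} [TopologicalSpace X] [TopologicalSpace Y]

/-- The inclusion of the first summand. -/
def inl (x : X) (y : Y) : C(X, Wedge x y) :=
  ⟨fun z => Quot.mk _ (.inl z), continuous_quot_mk.comp continuous_inl⟩

/-- The inclusion of the second summand. -/
def inr (x : X) (y : Y) : C(Y, Wedge x y) :=
  ⟨fun z => Quot.mk _ (.inr z), continuous_quot_mk.comp continuous_inr⟩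

theorem isPushoutSq (x : X) (y : Y) :
    IsPushoutSq (.const PUnit.{u + 1} x) (.const PUnit.{u + 1} y) (inl x y) (inr x y) where
  comm _ := Quot.sound .glue
  surj := by
    rintro ⟨z | z⟩
    · exact .inl ⟨z, rfl⟩
    · exact .inr ⟨z, rfl⟩
  desc p q hpq := by
    refine ⟨⟨Quot.lift (Sum.elim p q) ?_, continuous_quot_lift _ (by fun_prop)⟩,
      fun _ => rfl, fun _ => rfl⟩
    rintro _ _ ⟨⟩
    exact hpq ⟨⟩

theorem inl_eq_inr (x : X) (y : Y) : inl x y x = inr x y y := (isPushoutSq x y).comm ⟨⟩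

theorem homotopyEquiv_of_joined_left {x x' : X} {y : Y} (hy : IsCofib (.const PUnit.{u + 1} y))
    (h : Joined x x') : Nonempty (ContinuousMap.HomotopyEquiv (Wedge x y) (Wedge x' y)) := by
  obtain ⟨γ⟩ := h
  refine (isPushoutSq x y).symm.homotopyEquiv_of_homotopic hy (isPushoutSq x' y).symm ?_
  exact .of_paths (.const _ γ.toContinuousMap) (fun _ => γ.source) fun _ => γ.target

/-- A wedge sum of three spaces, formed at points `x₁` and `x₂` of the space `X` in the middle,
does not depend on the order in which the two outer spaces are attached. -/
theorem exists_isPushoutSq_swap {Z : Type u} [TopologicalSpace Z] (x₁ x₂ : X) (y : Y) (z : Z) :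
    ∃ g : C(Wedge x₂ z, Wedge (inl x₁ y x₂) z),
      IsPushoutSq (.const PUnit.{u + 1} y) (.const PUnit.{u + 1} (inl x₂ z x₁))
        ((inl (inl x₁ y x₂) z).comp (inr x₁ y)) g := by
  obtain ⟨g, hg1, hg2⟩ := (isPushoutSq x₂ z).desc ((inl (inl x₁ y x₂) z).comp (inl x₁ y))
    (inr (inl x₁ y x₂) z) fun _ => inl_eq_inr _ _
  refine ⟨g, fun _ => ?_, fun w => ?_, ?_⟩
  · simp [hg1, inl_eq_inr]
  · obtain ⟨w, rfl⟩ | ⟨w, rfl⟩ := (isPushoutSq (inl x₁ y x₂) z).surj w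
    · obtain ⟨w, rfl⟩ | ⟨w, rfl⟩ := (isPushoutSq x₁ y).surj w
      · exact .inr ⟨_, hg1 w⟩
      · exact .inl ⟨w, rfl⟩
    · exact .inr ⟨_, hg2 w⟩
  · intro T _ p q hpq
    obtain ⟨r, hr1, hr2⟩ := (isPushoutSq x₁ y).desc (q.comp (inl x₂ z)) p
      fun _ => (hpq ⟨⟩).symm
    obtain ⟨r', hr'1, hr'2⟩ := (isPushoutSq (inl x₁ y x₂) z).desc r (q.comp (inr x₂ z))
      fun _ => by simp [hr1, inl_eq_inr]
    refine ⟨r', fun w => by simp [hr'1, hr2], fun w => ?_⟩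
    obtain ⟨w, rfl⟩ | ⟨w, rfl⟩ := (isPushoutSq x₂ z).surj w
    · simp [hg1, hr'1, hr1]
    · simp [hg2, hr'2]

end Wedge

namespace Suspension

variable {A : Type u} [TopologicalSpace A]

/-- The first suspension point. -/
def north : Suspension A := TopJoin.inr ⟨1, by simp⟩

/-- The second suspension point. -/
def south : Suspension A := TopJoin.inr ⟨-1, by simp⟩

theorem eq_one_or_neg_one (e : Metric.sphere (0 : ℝ) 1) :
    e = ⟨1, by simp⟩ ∨ e = ⟨-1, by simp⟩ := by
  obtain ⟨e, he⟩ := e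
  rw [mem_sphere_zero_iff_norm, Real.norm_eq_abs] at he
  obtain rfl | rfl := eq_or_eq_neg_of_abs_eq he
  · exact .inl rfl
  · exact .inr rfl

theorem joined [Nonempty A] (z z' : Suspension A) : Joined z z' :=
  have : Nonempty (Metric.sphere (0 : ℝ) 1) := ⟨1, by simp⟩
  TopJoin.joined z z'

/-- The map from the cylinder to the suspension that collapses both ends. -/
theorem exists_cylinder_map : ∃ S : C(A × I, Suspension A),
    (∀ a (t : I), (t : ℝ) ≤ 1 / 2 → S (a, t) =
      TopJoin.mk (a, ⟨1, by simp⟩, unitInterval.trunc (1 - 2 * t))) ∧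
    ∀ a (t : I), 1 / 2 ≤ (t : ℝ) → S (a, t) =
      TopJoin.mk (a, ⟨-1, by simp⟩, unitInterval.trunc (2 * t - 1)) := by
  let F (p : A × I) : Suspension A := if (p.2 : ℝ) ≤ 1 / 2 then
      TopJoin.mk (p.1, ⟨1, by simp⟩, unitInterval.trunc (1 - 2 * p.2)) else
      TopJoin.mk (p.1, ⟨-1, by simp⟩, unitInterval.trunc (2 * p.2 - 1))
  have key (p : A × I) (hp : (p.2 : ℝ) = 1 / 2) :
      (TopJoin.mk (p.1, ⟨1, by simp⟩, unitInterval.trunc (1 - 2 * p.2)) : Suspension A) =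
      TopJoin.mk (p.1, ⟨-1, by simp⟩, unitInterval.trunc (2 * p.2 - 1)) := by
    rw [unitInterval.trunc_of_le (by rw [hp]; norm_num),
      unitInterval.trunc_of_le (by rw [hp]; norm_num), TopJoin.mk_zero, TopJoin.mk_zero]
  refine ⟨⟨F, Continuous.if_le (by fun_prop) (by fun_prop) (by fun_prop) (by fun_prop) key⟩,
    fun a t ht => if_pos ht, fun a t ht => ?_⟩
  obtain h | h := ht.eq_or_lt
  · exact (if_pos h.symm.le).trans (key (a, t) h.symm)
  · exact if_neg (not_le.2 h)

end Suspension

/-- Gluing a cylinder on `A` to `C` and `J` along constant maps at its ends gives a wedge sum of `C`,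
the suspension of `A`, and `J`. -/
theorem exists_isPushoutSq_wedge_suspension {A C J : Type u} [TopologicalSpace A]
    [TopologicalSpace C] [TopologicalSpace J] [Nonempty A] (c : C) (b : J) :
    ∃ (S : C(A × I, Wedge (Wedge.inl (Suspension.north (A := A)) c Suspension.south) b))
      (g : C(C ⊕ J, Wedge (Wedge.inl (Suspension.north (A := A)) c Suspension.south) b)),
      IsPushoutSq (cylinderEnds A)
        ⟨Sum.map (fun _ : A => c) (fun _ : A => b), by fun_prop⟩ S g := by
  obtain ⟨S, hS1, hS2⟩ := Suspension.exists_cylinder_map (A := A)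
  have hS0 (a) : S (a, 0) = Suspension.north := by
    rw [hS1 _ _ (by simp), unitInterval.trunc_of_ge (by simp), TopJoin.mk_one]
    rfl
  have hS1' (a) : S (a, 1) = Suspension.south := by
    rw [hS2 _ _ (by norm_num), unitInterval.trunc_of_ge (by norm_num), TopJoin.mk_one]
    rfl
  have hN : Nonempty (Metric.sphere (0 : ℝ) 1) := ⟨1, by simp⟩
  refine ⟨(Wedge.inl _ b).comp ((Wedge.inl _ c).comp S),
    ⟨Sum.elim (fun y => Wedge.inl _ b (Wedge.inr _ c y)) (fun y => Wedge.inr _ b y), by fun_prop⟩,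
    ?_, fun z => ?_, ?_⟩
  · rintro (a | a)
    · simp [cylinderEnds, hS0, Wedge.inl_eq_inr]
    · simp [cylinderEnds, hS1', Wedge.inl_eq_inr]
  · obtain ⟨z, rfl⟩ | ⟨z, rfl⟩ :=
      (Wedge.isPushoutSq (Wedge.inl Suspension.north c Suspension.south) b).surj z
    · obtain ⟨z, rfl⟩ | ⟨z, rfl⟩ := (Wedge.isPushoutSq _ _).surj z
      · refine .inl ?_
        obtain ⟨⟨a, e, s⟩, rfl⟩ := TopJoin.mk_surjective z
        have hs0 := s.2.1
        have hs1 := s.2.2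
        obtain rfl | rfl := Suspension.eq_one_or_neg_one e
        · refine ⟨(a, ⟨(1 - s) / 2, by constructor <;> linarith⟩), ?_⟩
          simp only [ContinuousMap.comp_apply]
          rw [hS1 _ _ (by simp only; linarith)]
          simp only
          rw [show 1 - 2 * ((1 - s : ℝ) / 2) = s by ring, unitInterval.trunc_coe]
        · refine ⟨(a, ⟨(1 + s) / 2, by constructor <;> linarith⟩), ?_⟩
          simp only [ContinuousMap.comp_apply]
          rw [hS2 _ _ (by simp only; linarith)]
          simp only
          rw [show 2 * ((1 + s : ℝ) / 2) - 1 = s by ring, unitInterval.trunc_coe]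
      · exact .inr ⟨.inl z, rfl⟩
    · exact .inr ⟨.inr z, rfl⟩
  · intro Z _ p q hpq
    have hp0 (a) : p (a, 0) = q (.inl c) := hpq (.inl a)
    have hp1 (a) : p (a, 1) = q (.inr b) := hpq (.inr a)
    let a₀ : A := Classical.arbitrary A
    obtain ⟨r, -, hrE, hr⟩ := TopJoin.exists_desc (A := A) (B := Metric.sphere (0 : ℝ) 1)
      (⟨fun a => p (a, unitInterval.trunc (1 / 2)), by fun_prop⟩ : C(A, Z))
      ⟨fun e => p (a₀, unitInterval.trunc ((1 - e) / 2)), by fun_prop⟩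
      ⟨fun x => p (x.1, unitInterval.trunc ((1 - x.2.1 * x.2.2) / 2)), by fun_prop⟩
      (fun a e => by simp) (fun a e => by
        obtain rfl | rfl := Suspension.eq_one_or_neg_one e <;>
          norm_num [hp0, hp1, unitInterval.trunc_of_le, unitInterval.trunc_of_ge])
    have hrN : r Suspension.north = q (.inl c) := by
      rw [Suspension.north, hrE]
      norm_num [hp0, unitInterval.trunc_of_le]
    have hrS : r Suspension.south = q (.inr b) := by
      rw [Suspension.south, hrE]
      norm_num [hp1, unitInterval.trunc_of_ge]
    obtain ⟨r', hr'1, hr'2⟩ := (Wedge.isPushoutSq Suspension.north c).desc r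
      (q.comp ⟨Sum.inl, by fun_prop⟩) fun _ => hrN
    obtain ⟨r'', hr''1, hr''2⟩ :=
      (Wedge.isPushoutSq (Wedge.inl Suspension.north c Suspension.south) b).desc r'
      (q.comp ⟨Sum.inr, by fun_prop⟩) fun _ => (hr'1 _).trans hrS
    refine ⟨r'', ?_, ?_⟩
    · rintro ⟨a, t⟩
      simp only [ContinuousMap.comp_apply]
      rw [hr''1, hr'1]
      obtain h | h := le_total (t : ℝ) (1 / 2)
      · have h1 : 1 - 2 * (t : ℝ) ∈ I := ⟨by linarith, by linarith [t.2.1]⟩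
        rw [hS1 _ _ h, hr]
        simp only [ContinuousMap.coe_mk]
        rw [unitInterval.coe_trunc h1, show (1 - 1 * (1 - 2 * t : ℝ)) / 2 = t by ring,
          unitInterval.trunc_coe]
      · have h1 : 2 * (t : ℝ) - 1 ∈ I := ⟨by linarith, by linarith [t.2.2]⟩
        rw [hS2 _ _ h, hr]
        simp only [ContinuousMap.coe_mk]
        rw [unitInterval.coe_trunc h1, show (1 - -1 * (2 * t - 1 : ℝ)) / 2 = t by ring,
          unitInterval.trunc_coe]
    · rintro (y | y)
      · exact (hr''1 _).trans (hr'2 _)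
      · exact hr''2 _

/-- A pushout of two null-homotopic maps, one of them a cofibration, is homotopy equivalent to a
wedge sum of the suspension of their common source and their targets. -/
theorem IsPushoutSq.homotopyEquiv_wedge {A C J P : Type u} [TopologicalSpace A]
    [TopologicalSpace C] [TopologicalSpace J] [TopologicalSpace P] [Nonempty A]
    {i : C(A, J)} {f : C(A, C)} {j : C(J, P)} {g : C(C, P)} (h : IsPushoutSq i f j g)
    (hi : IsCofib i) (a : Suspension A) (b : J) (c : C)
    (hb : IsCofib (.const PUnit.{u + 1} b)) (hc : IsCofib (.const PUnit.{u + 1} c))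
    (hib : i.Homotopic (.const A b)) (hfc : f.Homotopic (.const A c)) :
    Nonempty (ContinuousMap.HomotopyEquiv P (Wedge (Wedge.base a b) c)) := by
  obtain ⟨M, _, jM, gM, hM⟩ := exists_isPushoutSq (cylinderEnds A)
    (⟨Sum.map f i, by fun_prop⟩ : C(A ⊕ A, C ⊕ J))
  obtain ⟨e₁⟩ := h.homotopyEquiv_doubleMappingCylinder hi hM
  obtain ⟨S, gW, hW⟩ := exists_isPushoutSq_wedge_suspension (A := A) c b
  obtain ⟨e₂⟩ := hM.homotopyEquiv_of_homotopic (isCofib_cylinderEnds A) hW (by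
    obtain ⟨H⟩ := hib
    obtain ⟨H'⟩ := hfc
    obtain ⟨G, hG⟩ := exists_path_family (fun x s => (.inr (H (s, x)) : C ⊕ J)) (by fun_prop)
    obtain ⟨G', hG'⟩ := exists_path_family (fun x s => (.inl (H' (s, x)) : C ⊕ J)) (by fun_prop)
    refine .of_paths ⟨Sum.elim G' G, by fun_prop⟩ ?_ ?_
    · rintro (x | x) <;> simp [hG, hG']
    · rintro (x | x) <;> simp [hG, hG'])
  -- The wedge sums differ in their base points only, and these are moved one after the other.
  obtain ⟨g', hg'⟩ := Wedge.exists_isPushoutSq_swap a Suspension.north b c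
  obtain ⟨γ⟩ := Suspension.joined (Suspension.south (A := A)) a
  obtain ⟨e₃⟩ := (Wedge.isPushoutSq (Wedge.inl (Suspension.north (A := A)) c Suspension.south)
    b).symm.homotopyEquiv_of_homotopic hb hg' <| by
      let γ' := γ.map (Wedge.inl Suspension.north c).continuous
      exact .of_paths (.const _ γ'.toContinuousMap) (fun _ => γ'.source) fun _ => γ'.target
  obtain ⟨e₄⟩ := Wedge.homotopyEquiv_of_joined_left (x := Wedge.inl a b Suspension.north) hc
    ((Suspension.joined _ a).map (Wedge.inl a b).continuous)
  exact ⟨e₁.trans (e₂.trans (e₃.trans e₄))⟩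

/-! ### Polyhedral joins over stars and links -/

namespace FamilyJoin

open stdSimplex

variable {V : Type u} [Fintype V] [DecidableEq V] {X : V → Type v} [∀ i, Nonempty (X i)]

/-- The point with parameter `s` on the segment from `z` to the point `y` of the vertex `v`. If `z`
has a nonzero `v`-th coordinate, its `v`-th point is replaced by `y`, so that the segment does not
start at `z` in this case. -/
noncomputable def toward (v : V) (z : FamilyJoin X) (y : X v) (s : I) : FamilyJoin X :=
  mk (mix s z.weight (vertex v), Function.update z.point v y)

variable {v : V} {z : FamilyJoin X} {y : X v}

@[simp] theorem weight_toward (v : V) (z : FamilyJoin X) (y : X v) (s : I) :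
    (toward v z y s).weight = mix s z.weight (vertex v) := rfl

theorem toward_mk (t : stdSimplex ℝ V) (x : ∀ i, X i) (y : X v) (s : I) :
    toward v (mk (t, x)) y s = mk (mix s t (vertex v), Function.update x v y) := by
  refine mk_eq_mk.2 ⟨rfl, fun i hi => ?_⟩
  by_cases hiv : i = v
  · subst hiv
    simp
  · have ht : t.1 i ≠ 0 := (ne_zero_of_mix_ne_zero hi).resolve_right fun h =>
      hiv (vertex_ne_zero h)
    simp [hiv, point_mk ht]

theorem toward_zero (h : z.weight.1 v ≠ 0 → z.point v = y) : toward v z y 0 = z := by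
  conv_rhs => rw [← mk_weight_point z]
  refine mk_eq_mk.2 ⟨by simp, fun i hi => ?_⟩
  simp only [stdSimplex.mix_zero] at hi
  by_cases hiv : i = v
  · subst hiv
    simp [h hi]
  · simp [hiv]

theorem toward_one (z z' : FamilyJoin X) (y : X v) : toward v z y 1 = toward v z' y 1 := by
  refine mk_eq_mk.2 ⟨by simp, fun i hi => ?_⟩
  simp only [stdSimplex.mix_one] at hi
  obtain rfl := vertex_ne_zero hi
  simp

theorem support_toward_subset (v : V) (z : FamilyJoin X) (y : X v) (s : I) :
    (toward v z y s).support ⊆ insert v z.support := by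
  intro i hi
  rw [mem_support] at hi
  obtain h | h := ne_zero_of_mix_ne_zero hi
  · exact Finset.mem_insert_of_mem (mem_support.2 h)
  · exact Finset.mem_insert.2 (.inl (vertex_ne_zero h))

variable [∀ i, TopologicalSpace (X i)] [∀ i, CompactSpace (X i)] [∀ i, T2Space (X i)]

theorem continuous_toward (v : V) :
    Continuous fun p : FamilyJoin X × X v × I => toward v p.1 p.2.1 p.2.2 := by
  rw [(isQuotientMap_mk_prodMap_id (X v × I)).continuous_iff]
  have : Continuous fun p : (stdSimplex ℝ V × ∀ i, X i) × X v × I =>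
      mk (mix p.2.2 p.1.1 (vertex v), Function.update p.1.2 v p.2.1) := by
    refine continuous_mk.comp (Continuous.prodMk (by fun_prop) ?_)
    exact (by fun_prop : Continuous fun p : (stdSimplex ℝ V × ∀ i, X i) × X v × I =>
      p.1.2).update v (by fun_prop)
  exact this.congr fun p => (toward_mk _ _ _ _).symm

/-- If `v` is not a vertex of `L`, the join of the polyhedral join over `L` with `X v` embeds into
the join of all `X i`. Its image consists of the points whose support is a simplex of the cone on `L`
with apex `v`. -/
theorem exists_cone_map (L : PreAbstractSimplicialComplex V) (v : V) (hL : ∀ τ ∈ L, v ∉ τ)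
    [Nonempty (polyhedralJoin X L)] :
    ∃ θ : C(TopJoin (polyhedralJoin X L) (X v), FamilyJoin X),
      (∀ a, θ (TopJoin.inl a) = a) ∧ (∀ a y t, θ (TopJoin.mk (a, y, t)) = toward v a y t) ∧
      Function.Injective θ ∧
      ∀ z : FamilyJoin X, z ∈ range θ ↔ z.support ∈ L ∨
        v ∈ z.support ∧ (z.support.erase v = ∅ ∨ z.support.erase v ∈ L) := by
  have hmem (a : polyhedralJoin X L) : a.1.support ∈ L := mem_polyhedralJoin_iff.1 a.2
  have hv (a : polyhedralJoin X L) : a.1.weight.1 v = 0 := by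
    by_contra h
    exact hL _ (hmem a) (mem_support.2 h)
  let a₀ : polyhedralJoin X L := Classical.arbitrary _
  have hcont := continuous_toward (X := X) v
  obtain ⟨θ, hA, hB, hmk⟩ := TopJoin.exists_desc
    (⟨fun a => a.1, by fun_prop⟩ : C(polyhedralJoin X L, FamilyJoin X))
    (⟨fun y => toward v a₀.1 y 1, hcont.comp (by fun_prop :
      Continuous fun y => (a₀.1, y, (1 : I)))⟩ : C(X v, FamilyJoin X))
    ⟨fun p => toward v p.1.1 p.2.1 p.2.2, hcont.comp (by fun_prop :
      Continuous fun p : polyhedralJoin X L × X v × I => (p.1.1, p.2.1, p.2.2))⟩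
    (fun a y => toward_zero fun h => (h (hv a)).elim) (fun a y => toward_one _ _ _)
  simp only [ContinuousMap.coe_mk] at hA hB hmk
  have hw (a : polyhedralJoin X L) (y : X v) (t : I) : (toward v a.1 y t).weight.1 v = t := by
    rw [weight_toward, mix_apply, hv, vertex_self]
    simp
  refine ⟨θ, hA, fun a y t => hmk _, ?_, fun z => ⟨?_, ?_⟩⟩
  · intro p p' hpp
    obtain ⟨⟨a, y, t⟩, rfl⟩ := TopJoin.mk_surjective p
    obtain ⟨⟨a', y', t'⟩, rfl⟩ := TopJoin.mk_surjective p'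
    rw [hmk, hmk] at hpp
    obtain rfl : t = t' := by
      have := congrArg (fun z => z.weight.1 v) hpp
      simp only [hw] at this
      exact Subtype.ext this
    obtain ⟨h1, h2⟩ := mk_eq_mk.1 hpp
    simp only at h1 h2
    have hy : t ≠ 0 → y = y' := fun ht => by
      have h3 := h2 v (by
        change (toward v a.1 y t).weight.1 v ≠ 0
        rw [hw]
        exact fun h => ht (Subtype.ext h))
      simpa using h3
    have ha : t ≠ 1 → a = a' := fun ht => by
      have ht' : (1 - t : ℝ) ≠ 0 := fun h => ht (Subtype.ext (sub_eq_zero.1 h).symm)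
      refine Subtype.ext ?_
      rw [← mk_weight_point a.1, ← mk_weight_point a'.1]
      refine mk_eq_mk.2 ⟨Subtype.ext (funext fun i => ?_), fun i hi => ?_⟩
      · have h3 := congrArg (fun t => t.1 i) h1
        simp only [mix_apply] at h3
        exact mul_left_cancel₀ ht' (add_right_cancel h3)
      · simp only at hi
        have hiv : i ≠ v := by
          rintro rfl
          exact hi (hv a)
        have h3 := h2 i (by
          have h4 : (vertex (S := ℝ) v).1 i = 0 := by
            by_contra h
            exact hiv (vertex_ne_zero h)
          rw [mix_apply, h4, mul_zero, add_zero]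
          exact mul_ne_zero ht' hi)
        simpa [hiv] using h3
    by_cases ht : t = 0
    · subst ht
      rw [ha (by simp), TopJoin.mk_zero, TopJoin.mk_zero]
    · rw [hy ht]
      by_cases ht1 : t = 1
      · subst ht1
        rw [TopJoin.mk_one, TopJoin.mk_one]
      · rw [ha ht1]
  · rintro ⟨p, rfl⟩
    obtain ⟨⟨a, y, t⟩, rfl⟩ := TopJoin.mk_surjective p
    rw [hmk]
    have hsub := support_toward_subset v a.1 y t
    have hsub' : (toward v a.1 y t).support.erase v ⊆ a.1.support := by
      rwa [← Finset.subset_insert_iff]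
    by_cases hvs : v ∈ (toward v a.1 y t).support
    · refine .inr ⟨hvs, ?_⟩
      obtain h | h := Finset.eq_empty_or_nonempty ((toward v a.1 y t).support.erase v)
      · exact .inl h
      · exact .inr ((L.isRelLowerSet_faces (hmem a)).2 hsub' h)
    · rw [Finset.erase_eq_of_notMem hvs] at hsub'
      exact .inl ((L.isRelLowerSet_faces (hmem a)).2 hsub' (support_nonempty _))
  · rintro (h | ⟨hvz, h⟩)
    · exact ⟨TopJoin.inl ⟨z, mem_polyhedralJoin_iff.2 h⟩, hA _⟩
    · by_cases h1 : z.weight.1 v = 1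
      · refine ⟨TopJoin.mk (a₀, z.point v, 1), ?_⟩
        rw [hmk, toward_one _ z]
        conv_rhs => rw [← mk_weight_point z]
        refine mk_eq_mk.2 ⟨by simp [eq_vertex_of_eq_one h1], fun i hi => ?_⟩
        simp only [stdSimplex.mix_one] at hi
        obtain rfl := vertex_ne_zero hi
        simp
      · obtain ⟨s, t, hts, ht⟩ := exists_mix_vertex_eq z.weight v h1
        have hsub : (mk (t, z.point)).support ⊆ z.support.erase v := fun i hi => by
          obtain ⟨h2, h3⟩ := ht i (by simpa using hi)
          exact Finset.mem_erase.2 ⟨h3, mem_support.2 h2⟩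
        have hne := support_nonempty (mk (t, z.point))
        have hL' : z.support.erase v ∈ L := h.resolve_left (hne.mono hsub).ne_empty
        refine ⟨TopJoin.mk (⟨mk (t, z.point), mem_polyhedralJoin_iff.2
          ((L.isRelLowerSet_faces hL').2 hsub hne)⟩, z.point v, s), ?_⟩
        rw [hmk, toward_mk, hts, Function.update_eq_self, mk_weight_point]

end FamilyJoin

/-! ### Gluing along the link of a vertex -/

namespace FamilyJoin

open stdSimplex

variable {V : Type u} [Fintype V] {X : V → Type v} [∀ i, Nonempty (X i)]

theorem polyhedralJoin_mono {L L' : PreAbstractSimplicialComplex V} (h : ∀ τ ∈ L, τ ∈ L') :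
    polyhedralJoin X L ⊆ polyhedralJoin X L' := fun _ hz =>
  mem_polyhedralJoin_iff.2 (h _ (mem_polyhedralJoin_iff.1 hz))

theorem nonempty_polyhedralJoin {L : PreAbstractSimplicialComplex V} (h : L ≠ ⊥) :
    Nonempty (polyhedralJoin X L) := by
  classical
  obtain ⟨τ, hτ⟩ : ∃ τ, τ ∈ L := by
    by_contra! h'
    exact h (PreAbstractSimplicialComplex.ext (eq_empty_of_forall_notMem h'))
  obtain ⟨i, hi⟩ := (L.isRelLowerSet_faces hτ).1
  refine ⟨⟨mk (vertex i, fun _ => Classical.arbitrary _), mem_polyhedralJoin_iff.2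
    ((L.isRelLowerSet_faces hτ).2 (fun j hj => ?_) (support_nonempty _))⟩⟩
  obtain rfl := vertex_ne_zero (mem_support.1 hj)
  exact hi

variable [DecidableEq V] [∀ i, TopologicalSpace (X i)]

/-- The inclusion of the polyhedral join over the link of `v` into that over the deletion of `v`. -/
def linkInclusion (K : PreAbstractSimplicialComplex V) (v : V) :
    C(polyhedralJoin X (linkComplex K v), polyhedralJoin X (deletionComplex K v)) :=
  ⟨inclusion (polyhedralJoin_mono fun _ hτ => ⟨hτ.1, hτ.2.2⟩), continuous_inclusion _⟩

variable [∀ i, CompactSpace (X i)] [∀ i, T2Space (X i)]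

/-- The polyhedral join over `K` is obtained by gluing those over the deletion and the star of `v`
along that over the link of `v`, where the second one is the join of the third one with `X v`. -/
theorem exists_isPushoutSq_polyhedralJoin (K : PreAbstractSimplicialComplex V) (v : V)
    [Nonempty (polyhedralJoin X (linkComplex K v))] (hv : {v} ∈ K) :
    ∃ (j : C(TopJoin (polyhedralJoin X (linkComplex K v)) (X v), polyhedralJoin X K))
      (g : C(polyhedralJoin X (deletionComplex K v), polyhedralJoin X K)),
      IsPushoutSq TopJoin.inl (linkInclusion K v) j g := by
  obtain ⟨θ, hθA, hθ, hinj, hrange⟩ := exists_cone_map (X := X) (linkComplex K v) v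
    fun _ hτ => hτ.2.2
  have hw (a : polyhedralJoin X (linkComplex K v)) : a.1.weight.1 v = 0 := by
    by_contra h
    exact (mem_polyhedralJoin_iff.1 a.2).2.2 (mem_support.2 h)
  have hθK (p) : θ p ∈ polyhedralJoin X K := by
    rw [mem_polyhedralJoin_iff]
    obtain h | ⟨h1, h2 | h2⟩ := (hrange _).1 ⟨p, rfl⟩
    · exact h.1
    · rw [← Finset.insert_erase h1, h2]
      exact hv
    · rw [← Finset.insert_erase h1]
      exact h2.2.1
  let j : C(TopJoin (polyhedralJoin X (linkComplex K v)) (X v), polyhedralJoin X K) :=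
    ⟨fun p => ⟨θ p, hθK p⟩, by fun_prop⟩
  let g : C(polyhedralJoin X (deletionComplex K v), polyhedralJoin X K) :=
    ⟨inclusion (polyhedralJoin_mono fun _ hτ => hτ.1), continuous_inclusion _⟩
  have hcomm (a) : j (TopJoin.inl a) = g (linkInclusion K v a) := Subtype.ext (hθA a)
  have hsurj (z) : (∃ p, j p = z) ∨ ∃ c, g c = z := by
    have hz := mem_polyhedralJoin_iff.1 z.2
    by_cases hvz : v ∈ z.1.support
    · left
      have hz' : z.1 ∈ range θ := by
        rw [hrange]
        refine .inr ⟨hvz, (Finset.eq_empty_or_nonempty _).imp_right fun hne =>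
          ⟨(K.isRelLowerSet_faces hz).2 (Finset.erase_subset _ _) hne, ?_, by simp⟩⟩
        rwa [Finset.insert_erase hvz]
      obtain ⟨p, hp⟩ := hz'
      exact ⟨p, Subtype.ext hp⟩
    · exact .inr ⟨⟨z.1, mem_polyhedralJoin_iff.2 ⟨hz, hvz⟩⟩, rfl⟩
  have hjg (p) (c) (h : j p = g c) : ∃ a, p = TopJoin.inl a ∧ c = linkInclusion K v a := by
    have h' : θ p = c.1 := congrArg Subtype.val h
    have hc : c.1.weight.1 v = 0 := by
      by_contra h
      exact (mem_polyhedralJoin_iff.1 c.2).2 (mem_support.2 h)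
    obtain ⟨⟨a, y, t⟩, rfl⟩ := TopJoin.mk_surjective p
    have ht : t = 0 := by
      rw [← h', hθ, weight_toward, mix_apply, hw, vertex_self] at hc
      ext
      simpa using hc
    subst ht
    refine ⟨a, TopJoin.mk_zero a y, Subtype.ext ?_⟩
    rw [← h', TopJoin.mk_zero, hθA]
    rfl
  have hquot : Topology.IsQuotientMap (Sum.elim j g) :=
    .of_surjective_continuous (fun z => by
      obtain ⟨p, hp⟩ | ⟨c, hc⟩ := hsurj z
      exacts [⟨.inl p, hp⟩, ⟨.inr c, hc⟩]) (by fun_prop)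
  refine ⟨j, g, hcomm, hsurj, fun {Z} _ p q hpq => ?_⟩
  have hmix (x c) (h : j x = g c) : p x = q c := by
    obtain ⟨a, rfl, rfl⟩ := hjg x c h
    exact hpq a
  let e : C(TopJoin (polyhedralJoin X (linkComplex K v)) (X v) ⊕
      polyhedralJoin X (deletionComplex K v), polyhedralJoin X K) := ⟨Sum.elim j g, by fun_prop⟩
  obtain ⟨r, hr⟩ : ∃ r : C(polyhedralJoin X K, Z), r.comp e = ⟨Sum.elim p q, by fun_prop⟩ := by
    refine ⟨_, Topology.IsQuotientMap.lift_comp (f := e) hquot _ ?_⟩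
    rintro (x | c) (x' | c') h
    · have : x = x' := hinj (congrArg Subtype.val h)
      exact congrArg p this
    · exact hmix x c' h
    · exact (hmix x' c h.symm).symm
    · have : c = c' := Subtype.ext (congrArg (fun z => z.1) (show g c = g c' from h))
      exact congrArg q this
  have hr (x) : r (e x) = Sum.elim p q x := DFunLike.congr_fun hr x
  exact ⟨r, fun x => hr (.inl x), fun c => hr (.inr c)⟩

/-- Points of the join of `X v` with the polyhedral join over the link of `v` are neighbourhood
deformation retracts since this join is the polyhedral join over the star of `v`. -/
theorem exists_ndrPoint_topJoin_link (hX : ∀ i (x : X i), Nonempty (NDRPoint x))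
    (K : PreAbstractSimplicialComplex V) (v : V)
    [Nonempty (polyhedralJoin X (linkComplex K v))] (hv : {v} ∈ K)
    (b : TopJoin (polyhedralJoin X (linkComplex K v)) (X v)) : Nonempty (NDRPoint b) := by
  obtain ⟨θ, -, -, hinj, hrange⟩ := exists_cone_map (X := X) (linkComplex K v) v
    fun _ hτ => hτ.2.2
  have hstar : range θ = polyhedralJoin X (starComplex K v) := by
    ext z
    rw [hrange, mem_polyhedralJoin_iff]
    constructor
    · rintro (h | ⟨h1, h2 | h2⟩)
      · exact ⟨h.1, h.2.1⟩
      · have : z.support = {v} := by rw [← Finset.insert_erase h1, h2]; rfl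
        rw [this]
        exact ⟨hv, by simpa using hv⟩
      · have : z.support ∈ K := by rw [← Finset.insert_erase h1]; exact h2.2.1
        exact ⟨this, by rwa [Finset.insert_eq_of_mem h1]⟩
    · rintro ⟨h1, h2⟩
      by_cases h3 : v ∈ z.support
      · refine .inr ⟨h3, (Finset.eq_empty_or_nonempty _).imp_right fun hne =>
          ⟨(K.isRelLowerSet_faces h1).2 (Finset.erase_subset _ _) hne, ?_, by simp⟩⟩
        rwa [Finset.insert_erase h3]
      · exact .inl ⟨h1, h2, h3⟩
  let e : TopJoin (polyhedralJoin X (linkComplex K v)) (X v) ≃ₜ range θ :=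
    Continuous.homeoOfEquivCompactToT2 (f := Equiv.ofInjective θ hinj)
      (θ.continuous.subtype_mk _)
  let e' := e.trans (Homeomorph.setCongr hstar)
  exact (exists_ndrPoint_polyhedralJoin hX _ (e' b)).map (NDRPoint.ofHomeomorph e')

/-- If the deletion of `v` is the star of `w`, the inclusion of the link of `v` into the deletion of
`v` induces a null-homotopic map of polyhedral joins: it is contracted along segments to a point of
the vertex `w`, chosen such that a segment joins it to `c`. -/
theorem linkInclusion_homotopic_const (K : PreAbstractSimplicialComplex V) {v w : V} (hvw : v ≠ w)
    (hvw' : {v, w} ∉ K) (hdel : deletionComplex K v = starComplex K w)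
    (c : polyhedralJoin X (deletionComplex K v)) :
    (linkInclusion K v).Homotopic (.const _ c) := by
  have hmem (z : polyhedralJoin X (deletionComplex K v)) (y : X w) (s : I) :
      toward w z.1 y s ∈ polyhedralJoin X (deletionComplex K v) := by
    have h1 : z.1.support ∈ deletionComplex K v := mem_polyhedralJoin_iff.1 z.2
    have h2 : z.1.support ∈ starComplex K w := hdel ▸ h1
    refine mem_polyhedralJoin_iff.2 (((deletionComplex K v).isRelLowerSet_faces
      (show insert w z.1.support ∈ deletionComplex K v from ⟨h2.2, ?_⟩)).2
      (support_toward_subset _ _ _ _) (support_nonempty _))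
    simpa [hvw] using h1.2
  let y : X w := c.1.point w
  obtain ⟨G, hG⟩ := exists_path_family (fun (z : polyhedralJoin X (deletionComplex K v)) (s : I) =>
    (⟨toward w z.1 y s, hmem z y s⟩ : polyhedralJoin X (deletionComplex K v)))
    (((continuous_toward w).comp (by fun_prop :
      Continuous fun p : polyhedralJoin X (deletionComplex K v) × I => (p.1.1, y, p.2))).subtype_mk
      fun _ => hmem _ _ _)
  refine .trans (.of_paths (g := .const _ (G c 1)) (G.comp (linkInclusion K v)) (fun a => ?_)
    fun a => ?_) ?_
  · rw [ContinuousMap.comp_apply, hG]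
    refine Subtype.ext (toward_zero fun h => (hvw' ?_).elim)
    have ha := mem_polyhedralJoin_iff.1 a.2
    refine (K.isRelLowerSet_faces ha.2.1).2 ?_ (Finset.insert_nonempty _ _)
    intro i hi
    obtain rfl | hi := Finset.mem_insert.1 hi
    · exact Finset.mem_insert_self _ _
    · rw [Finset.mem_singleton.1 hi]
      exact Finset.mem_insert_of_mem (mem_support.2 h)
  · rw [ContinuousMap.comp_apply, hG, ContinuousMap.const_apply, hG]
    exact Subtype.ext (toward_one _ _ _)
  · refine (ContinuousMap.Homotopic.of_paths (.const _ (G c)) (fun a => ?_) fun a => rfl).symm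
    rw [ContinuousMap.const_apply, hG]
    exact Subtype.ext (toward_zero fun _ => rfl)

end FamilyJoin

theorem TopJoin.inl_homotopic_const {A B : Type*} [TopologicalSpace A] [TopologicalSpace B]
    [Nonempty A] [Nonempty B] (z : TopJoin A B) :
    (TopJoin.inl : C(A, TopJoin A B)).Homotopic (.const A z) := by
  let b : B := Classical.arbitrary B
  obtain ⟨G, hG⟩ := exists_path_family (fun (a : A) (s : I) => TopJoin.mk (a, b, s)) (by fun_prop)
  refine .trans (.of_paths G (g := .const A (TopJoin.inr b)) (fun a => ?_) fun a => ?_)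
    (ContinuousMap.homotopic_const_iff.2 (TopJoin.joined _ _))
  · rw [hG, TopJoin.mk_zero]
  · rw [hG, TopJoin.mk_one, ContinuousMap.const_apply]

theorem theorem4 {V : Type*} [Fintype V] [DecidableEq V]
    (K : PreAbstractSimplicialComplex V)
    (X : V → Type*) [∀ i, TopologicalSpace (X i)] [∀ i, T2Space (X i)] [∀ i, Nonempty (X i)]
    [∀ i, Topology.CWComplex (univ : Set (X i))]
    [∀ i, Topology.CWComplex.Finite (univ : Set (X i))]
    (v w : V)
    (hlink : linkComplex K v ≠ ⊥)
    (hdel : deletionComplex K v = starComplex K w)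
    (a : Suspension (polyhedralJoin X (linkComplex K v)))
    (b : TopJoin (polyhedralJoin X (linkComplex K v)) (X v))
    (c : polyhedralJoin X (deletionComplex K v)) :
    Nonempty (ContinuousMap.HomotopyEquiv
      (polyhedralJoin X K)
      (Wedge (Wedge.base a b) c)) := by
  have (i : V) : CompactSpace (X i) := compactSpace_of_finite_CWComplex (X i)
  have hX (i : V) (x : X i) : Nonempty (NDRPoint x) := exists_ndrPoint_of_finite_CWComplex x
  have hA : Nonempty (polyhedralJoin X (linkComplex K v)) :=
    FamilyJoin.nonempty_polyhedralJoin hlink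
  have hτ : hA.some.1.support ∈ linkComplex K v := FamilyJoin.mem_polyhedralJoin_iff.1 hA.some.2
  have hv : {v} ∈ K := (K.isRelLowerSet_faces hτ.2.1).2 (by simp) (by simp)
  -- Since `v` is not a vertex of its deletion, it is not a vertex of the star of `w`.
  have hvw' : {v, w} ∉ K := fun h => by
    have h' : {v} ∈ deletionComplex K v := by
      rw [hdel]
      exact ⟨hv, by rwa [Finset.pair_comm] at h⟩
    exact h'.2 (by simp)
  have hvw : v ≠ w := by
    rintro rfl
    exact hvw' (by simpa using hv)
  obtain ⟨j, g, h⟩ := FamilyJoin.exists_isPushoutSq_polyhedralJoin (X := X) K v hv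
  obtain ⟨Nb⟩ := FamilyJoin.exists_ndrPoint_topJoin_link hX K v hv b
  obtain ⟨Nc⟩ := FamilyJoin.exists_ndrPoint_polyhedralJoin hX _ c
  exact h.homotopyEquiv_wedge TopJoin.isCofib_inl a b c Nb.isCofib Nc.isCofib
    (TopJoin.inl_homotopic_const b) (FamilyJoin.linkInclusion_homotopic_const K hvw hvw' hdel c)
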